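/- Let $(W,\{s_i\}_{i\in S})$ be a finite Coxeter group with length function $\ell$, let $\delta$ be a group automorphism of $W$ sending simple reflections to simple reflections, and let $\tilde W=\langle\delta\rangle\ltimes W$, where $\langle\delta\rangle\subset\mathrm{Aut}(W)$; put $\ell(\delta^k w)=\ell(w)$ for $k\in\mathbb Z$, $w\in W$. Let $V$ be a real inner product space with a faithful linear isometric action of $\tilde W$ such that each $s_i$ acts as the orthogonal reflection in the hyperplane orthogonal to a vector $e_i\neq 0$. Let $\mathfrak H$ be the set of hyperplanes $H\subset V$ whose orthogonal reflection belongs to $W$; the connected components of $V-\bigcup_{H\in\mathfrak H}H$ are called (Weyl) chambers. Assume that $C=\{v\in V : (v,e_i)>0 \text{ for all } i\in S\}$ is a chamber and that $\delta(C)=C$. A conjugacy class $\mathcal O$ of $\tilde W$ is called elliptic if for some (equivalently, any) $\tilde w\in\mathcal O$ the points of $V$ fixed by $\tilde w$ are contained in $V^W$. Let $\mathcal O_{\min}$ be the set of elements of minimal length in $\mathcal O$. For $\tilde w\in\mathcal O_{\min}$ let $\mathcal P_{\tilde w}$ be the set of all finite sequences $(i_1,\dots,i_t)$ in $S$, $t\ge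 0$, such that in the chain $$\tilde w,\quad s_{i_1}\tilde w s_{i_1},\quad s_{i_2}s_{i_1}\tilde w s_{i_1}s_{i_2},\quad\dots,\quad s_{i_t}\cdots s_{i_1}\tilde w s_{i_1}\cdots s_{i_t}$$ the length never increases (so that, by minimality, it is constant). Let $W_{\tilde w}=\{w\in W : \ell(w^{-1}\tilde w w)=\ell(\tilde w)\}$, and let $\tau_{\tilde w}:\mathcal P_{\tilde w}\to W_{\tilde w}$ be the map $(i_1,\dots,i_t)\mapsto s_{i_1}\cdots s_{i_t}$. Let $C_{\tilde w}$ be the set of chambers $A=w(C)$, $w\in W$, with $\ell(w^{-1}\tilde w w)=\ell(\tilde w)$. Call $v\in V$ subregular if it lies on no $H\in\mathfrak H$ or on exactly one $H\in\mathfrak H$, and let $V^{subreg}$ be the set of subregular elements. **Theorem.** Let $\mathcal O$ be an elliptic conjugacy class of $\tilde W$ and let $\tilde w\in\mathcal O_{\min}$. Then the map $\tau_{\tilde w}:\mathcal P_{\tilde w}\to W_{\tilde w}$ is surjective, and (equivalently) the set $\bigl(\bigcup_{A\in C_{\tilde w}}\bar A\bigr)\cap V^{subreg}$ is connected. -/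

import Mathlib

open scoped RealInnerProductSpace

noncomputable section

namespace TwistedCoxeter

section Combinatorics

variable {B W : Type*} [Group W] {M : CoxeterMatrix B}

/-- The group `⟨δ⟩ ⋉ W`, where `⟨δ⟩` is the cyclic subgroup of `Aut W` generated by `δ`. -/
abbrev TwistedGroup (δ : MulAut W) : Type _ :=
  W ⋊[(Subgroup.zpowers δ).subtype] (Subgroup.zpowers δ)

/-- The inclusion of `W` in `⟨δ⟩ ⋉ W`. -/
def incl (δ : MulAut W) : W →* TwistedGroup δ := SemidirectProduct.inl

/-- The element `δ` of `⟨δ⟩ ⋉ W`. -/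
def deltaElt (δ : MulAut W) : TwistedGroup δ :=
  SemidirectProduct.inr ⟨δ, Subgroup.mem_zpowers δ⟩

/-- `δ` sends simple reflections to simple reflections. -/
def PreservesSimple (cs : CoxeterSystem M W) (δ : MulAut W) : Prop :=
  ∀ i : B, ∃ j : B, δ (cs.simple i) = cs.simple j

/-- The length on `⟨δ⟩ ⋉ W`: an element is written uniquely as `δ ^ k * w`, with `w ∈ W`, and its
length is the length of `w`. (The `left` component of `δ ^ k * w` is `δ ^ k (w)`.) -/
def len (cs : CoxeterSystem M W) (δ : MulAut W) (x : TwistedGroup δ) : ℕ :=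
  cs.length ((x.right⁻¹ : MulAut W) x.left)

theorem len_deltaElt_zpow_mul (cs : CoxeterSystem M W) (δ : MulAut W) (k : ℤ) (w : W) :
    len cs δ (deltaElt δ ^ k * incl δ w) = cs.length w := by
  have h : deltaElt δ ^ k
      = SemidirectProduct.inr ((⟨δ, Subgroup.mem_zpowers δ⟩ : Subgroup.zpowers δ) ^ k) :=
    (map_zpow SemidirectProduct.inr _ k).symm
  rw [h]
  generalize (⟨δ, Subgroup.mem_zpowers δ⟩ : Subgroup.zpowers δ) ^ k = g
  simp [len, incl]

/-- The set `O_min` of elements of minimal length of a conjugacy class. -/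
def minSet (cs : CoxeterSystem M W) (δ : MulAut W) (O : ConjClasses (TwistedGroup δ)) :
    Set (TwistedGroup δ) :=
  {x | x ∈ O.carrier ∧ ∀ y ∈ O.carrier, len cs δ x ≤ len cs δ y}

/-- Conjugation by the simple reflection `s i`, that is, `x ↦ s i * x * s i`. -/
def simpleConj (cs : CoxeterSystem M W) (δ : MulAut W) (i : B) (x : TwistedGroup δ) :
    TwistedGroup δ :=
  incl δ (cs.simple i) * x * incl δ (cs.simple i)

/-- `(i₁, …, i_t)` is a path starting at `x`: each of the successive conjugations
`x → s_{i₁} x s_{i₁} → s_{i₂} s_{i₁} x s_{i₁} s_{i₂} → ⋯` does not increase the length. -/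
def IsPath (cs : CoxeterSystem M W) (δ : MulAut W) : TwistedGroup δ → List B → Prop
  | _, [] => True
  | x, i :: l => len cs δ (simpleConj cs δ i x) ≤ len cs δ x ∧ IsPath cs δ (simpleConj cs δ i x) l

/-- The set of paths starting at `x`. -/
def paths (cs : CoxeterSystem M W) (δ : MulAut W) (x : TwistedGroup δ) : Set (List B) :=
  {l | IsPath cs δ x l}

/-- The set `W_x = {w ∈ W : ℓ(w⁻¹ x w) = ℓ(x)}`. -/
def lengthFixers (cs : CoxeterSystem M W) (δ : MulAut W) (x : TwistedGroup δ) : Set W :=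
  {w | len cs δ ((incl δ w)⁻¹ * x * incl δ w) = len cs δ x}

theorem simpleConj_eq (cs : CoxeterSystem M W) (δ : MulAut W) (i : B) (x : TwistedGroup δ) :
    simpleConj cs δ i x = (incl δ (cs.simple i))⁻¹ * x * incl δ (cs.simple i) := by
  rw [simpleConj, ← map_inv, cs.inv_simple]

theorem simpleConj_mem_minSet (cs : CoxeterSystem M W) (δ : MulAut W)
    {O : ConjClasses (TwistedGroup δ)} {x : TwistedGroup δ} (hx : x ∈ minSet cs δ O) {i : B}
    (h : len cs δ (simpleConj cs δ i x) ≤ len cs δ x) :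
    simpleConj cs δ i x ∈ minSet cs δ O := by
  refine ⟨?_, fun y hy => h.trans (hx.2 y hy)⟩
  have h1 := ConjClasses.mem_carrier_iff_mk_eq.1 hx.1
  rw [ConjClasses.mem_carrier_iff_mk_eq, ← h1, ConjClasses.mk_eq_mk_iff_isConj, simpleConj_eq]
  exact (isConj_iff.2 ⟨(incl δ (cs.simple i))⁻¹, by simp⟩ : IsConj x _).symm

/-- For `x` of minimal length in its class, the product along a path lies in `W_x`. -/
theorem wordProd_mem_lengthFixers (cs : CoxeterSystem M W) (δ : MulAut W)
    {O : ConjClasses (TwistedGroup δ)} (l : List B) :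
    ∀ {x : TwistedGroup δ}, x ∈ minSet cs δ O → l ∈ paths cs δ x →
      cs.wordProd l ∈ lengthFixers cs δ x := by
  induction l with
  | nil => intro x _ _; simp [lengthFixers]
  | cons i l ih =>
    intro x hx hl
    have hm := simpleConj_mem_minSet cs δ hx hl.1
    have h1 : len cs δ (simpleConj cs δ i x) = len cs δ x :=
      le_antisymm hl.1 (hx.2 _ hm.1)
    have h2 := ih hm hl.2
    simp only [lengthFixers, Set.mem_ofPred_eq, h1] at h2 ⊢
    rw [← h2, simpleConj_eq, cs.wordProd_cons]
    simp [mul_assoc]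

/-- The map `τ_x` from the paths starting at `x` to `W_x`, `(i₁, …, i_t) ↦ s_{i₁} ⋯ s_{i_t}`,
for an element `x` of minimal length in its conjugacy class. -/
def tau (cs : CoxeterSystem M W) (δ : MulAut W) {O : ConjClasses (TwistedGroup δ)}
    {x : TwistedGroup δ} (hx : x ∈ minSet cs δ O) (p : paths cs δ x) : lengthFixers cs δ x :=
  ⟨cs.wordProd p.1, wordProd_mem_lengthFixers cs δ p.1 hx p.2⟩

end Combinatorics

section Geometry

variable {B W : Type*} [Group W] {M : CoxeterMatrix B} {δ : MulAut W}
variable {V : Type*} [NormedAddCommGroup V] [InnerProductSpace ℝ V]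

/-- The hyperplanes `H` of `V` such that the orthogonal reflection `s_H` belongs to `W`. -/
def hyperplanes (ρ : TwistedGroup δ →* (V ≃ₗᵢ[ℝ] V)) : Set (Submodule ℝ V) :=
  {H | ∃ v : V, v ≠ 0 ∧ H = (ℝ ∙ v)ᗮ ∧ ∃ w : W, ρ (incl δ w) = (ℝ ∙ v)ᗮ.reflection}

/-- The complement in `V` of the union of the reflection hyperplanes. -/
def hyperplaneComplement (ρ : TwistedGroup δ →* (V ≃ₗᵢ[ℝ] V)) : Set V :=
  {v | ∀ H ∈ hyperplanes ρ, v ∉ H}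

/-- A Weyl chamber is a connected component of the complement of the reflection hyperplanes. -/
def IsChamber (ρ : TwistedGroup δ →* (V ≃ₗᵢ[ℝ] V)) (A : Set V) : Prop :=
  ∃ x ∈ hyperplaneComplement ρ, A = connectedComponentIn (hyperplaneComplement ρ) x

/-- The open cone `{x : (x, e i) > 0 for all i}`. -/
def openCone (e : B → V) : Set V := {x | ∀ i, 0 < ⟪x, e i⟫}

/-- A realization of `⟨δ⟩ ⋉ W` on a real inner product space `V`: a faithful isometric action
for which every simple reflection `s i` acts as the orthogonal reflection with root `e i`, the
cone `C = {x : (x, e i) > 0 for all i}` is a Weyl chamber (the fundamental one), and `δ`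
preserves `C`. -/
structure Realization (cs : CoxeterSystem M W) (δ : MulAut W) (V : Type*)
    [NormedAddCommGroup V] [InnerProductSpace ℝ V] where
  /-- The action. -/
  ρ : TwistedGroup δ →* (V ≃ₗᵢ[ℝ] V)
  injective : Function.Injective ρ
  /-- The simple roots. -/
  e : B → V
  ne_zero : ∀ i, e i ≠ 0
  map_simple : ∀ i, ρ (incl δ (cs.simple i)) = (ℝ ∙ e i)ᗮ.reflection
  isChamber_openCone : IsChamber ρ (openCone e)
  image_delta : ρ (deltaElt δ) '' openCone e = openCone e

namespace Realization

variable {cs : CoxeterSystem M W} (R : Realization cs δ V)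

/-- The fundamental chamber. -/
def fundamentalChamber : Set V := openCone R.e

/-- The set `V^W` of points fixed by `W`. -/
def fixedByW : Set V := {v | ∀ w : W, R.ρ (incl δ w) v = v}

/-- A conjugacy class is elliptic if the points of `V` fixed by some element of the class are
contained in `V^W`. -/
def IsElliptic (O : ConjClasses (TwistedGroup δ)) : Prop :=
  ∃ x ∈ O.carrier, {v : V | R.ρ x v = v} ⊆ R.fixedByW

/-- `v` is a regular point of `K`. -/
def IsRegularPoint (K : Set V) (v : V) : Prop :=
  v ∈ K ∧ ∀ H ∈ hyperplanes R.ρ, v ∈ H → K ⊆ H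

/-- The set of subregular elements: those regular in `V` or in some reflection hyperplane. -/
def subregular : Set V :=
  {v | R.IsRegularPoint Set.univ v ∨ ∃ H ∈ hyperplanes R.ρ, R.IsRegularPoint (H : Set V) v}

/-- The set of Weyl chambers `A = w(C)`, `w ∈ W`, such that `ℓ(w⁻¹ x w) = ℓ(x)`. -/
def goodChambers (x : TwistedGroup δ) : Set (Set V) :=
  {A | IsChamber R.ρ A ∧ ∃ w : W, R.ρ (incl δ w) '' R.fundamentalChamber = A ∧
    len cs δ ((incl δ w)⁻¹ * x * incl δ w) = len cs δ x}

/-- The intersection of the union of the closures of these chambers with the subregular set. -/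
def goodRegion (x : TwistedGroup δ) : Set V :=
  (⋃ A ∈ R.goodChambers x, closure A) ∩ R.subregular

end Realization

end Geometry

end TwistedCoxeter

end

/-! Let x be the isometry given by the minimal length element. The length of w⁻¹xw is the number of
reflection hyperplanes separating the chamber w(C) from its image under x (`length_eq_sep`,
`disp_eq_len`), and w changes by right multiplication by a simple reflection when a wall is crossed.
Both assertions therefore follow once any two chambers of minimal displacement are joined by a
gallery of such chambers. This is `exists_chain_of_minimal`, a statement about a finite arrangement
stable under an isometry whose fixed points lie on every hyperplane.

Crossing a hyperplane at a point u on no other hyperplane can raise the displacement only if x u and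
x⁻¹ u both lie strictly on the side being left (`disp_le_of_cross`). The flow u' = x u + x⁻¹ u, the
gradient flow of ⟪x u, u⟫, never crosses in this way: on the hyperplane of a its velocity pairs with
a to ⟪a, x u⟫ + ⟪a, x⁻¹ u⟫. Let c be the largest eigenvalue of x + x⁻¹ seen by the roots and K its
eigenspace. A generic flow line leads from any chamber, without raising the displacement, to one
whose closure contains a regular point of K (`exists_chain_near_rotSpace`).

The fixed point hypothesis gives c < 2. If c ≤ -2, then x is -1 on the roots and every generic
segment is allowed. If |c| < 2, then x u and x⁻¹ u lie on opposite sides wherever a generic segment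
in K meets a hyperplane not containing K, so one can move freely along K
(`exists_chain_along_rotSpace`). What remains is the smaller arrangement of hyperplanes containing
K, to which induction applies.

The length formula rests on the exchange condition, hence on every simple root defining a genuine
wall of C (`exists_wall_point`). -/

namespace TwistedCoxeter

open Filter Topology Set

/-! ### Displacement of chambers under an isometry, and chains of chambers along a path. -/

section Arrangement

variable {V : Type*} [NormedAddCommGroup V] [InnerProductSpace ℝ V]

/-- A point on none of the hyperplanes orthogonal to the vectors of `Φ`. -/
def Generic (Φ : Finset V) (p : V) : Prop := ∀ a ∈ Φ, ⟪a, p⟫ ≠ 0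

open Classical in
/-- The number of vectors of `Φ` which are positive on `p` and negative on `q`. -/
noncomputable def sep (Φ : Finset V) (p q : V) : ℕ :=
  (Φ.filter fun a => 0 < ⟪a, p⟫ ∧ ⟪a, q⟫ < 0).card

/-- The number of hyperplanes separating `p` from its image under `x`. -/
noncomputable def disp (Φ : Finset V) (x : V ≃ₗᵢ[ℝ] V) (p : V) : ℕ := sep Φ p (x p)

/-- A finite symmetric set of unit vectors stable under the isometry `x`. -/
structure IsArrangement (Φ : Finset V) (x : V ≃ₗᵢ[ℝ] V) : Prop where
  norm_eq : ∀ a ∈ Φ, ‖a‖ = 1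
  neg_mem : ∀ a ∈ Φ, -a ∈ Φ
  map_mem : ∀ a ∈ Φ, x a ∈ Φ

/-- The point `u` lies in the closure of the chamber of `p`. -/
def Near (Φ : Finset V) (u p : V) : Prop := ∀ a ∈ Φ, 0 < ⟪a, u⟫ → 0 < ⟪a, p⟫

/-- `p` and `q` lie in the same or in adjacent chambers, and the displacement does not increase
from `p` to `q`. -/
def Step (Φ : Finset V) (x : V ≃ₗᵢ[ℝ] V) (p q : V) : Prop :=
  Generic Φ p ∧ Generic Φ q ∧ disp Φ x q ≤ disp Φ x p ∧
    ∃ a, ∀ b ∈ Φ, b ≠ a → b ≠ -a → (0 < ⟪b, p⟫ ↔ 0 < ⟪b, q⟫)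

variable {Φ : Finset V} {x : V ≃ₗᵢ[ℝ] V} {p q : V}

namespace IsArrangement

theorem symm_mem (h : IsArrangement Φ x) {a : V} (ha : a ∈ Φ) : x.symm a ∈ Φ := by
  classical
  have h1 : Φ.image x = Φ :=
    Finset.eq_of_subset_of_card_le (Finset.image_subset_iff.2 h.map_mem)
      (Finset.card_image_of_injective _ x.injective).ge
  rw [← h1] at ha
  obtain ⟨b, hb, rfl⟩ := Finset.mem_image.1 ha
  simpa using hb

end IsArrangement

theorem inner_map_eq_inner_symm (x : V ≃ₗᵢ[ℝ] V) (a v : V) : ⟪a, x v⟫ = ⟪x.symm a, v⟫ := by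
  rw [← x.inner_map_map (x.symm a) v, x.apply_symm_apply]

theorem inner_symm_eq_inner_map (x : V ≃ₗᵢ[ℝ] V) (a v : V) : ⟪a, x.symm v⟫ = ⟪x a, v⟫ := by
  rw [← x.inner_map_map a, x.apply_symm_apply]

theorem Generic.pos_or_neg (hp : Generic Φ p) {a : V} (ha : a ∈ Φ) : 0 < ⟪a, p⟫ ∨ ⟪a, p⟫ < 0 :=
  (hp a ha).lt_or_gt.symm

theorem symm_eq_neg_iff (x : V ≃ₗᵢ[ℝ] V) (a : V) : x.symm a = -a ↔ x a = -a := by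
  rw [x.symm_apply_eq, map_neg, eq_neg_iff_add_eq_zero, eq_neg_iff_add_eq_zero, add_comm]

theorem symm_eq_self_iff (x : V ≃ₗᵢ[ℝ] V) (a : V) : x.symm a = a ↔ x a = a := by
  rw [x.symm_apply_eq, eq_comm]

theorem Near.neg (hΦ : IsArrangement Φ x) {u : V} (h : Near Φ u p) {a : V} (ha : a ∈ Φ)
    (h0 : ⟪a, u⟫ < 0) : ⟪a, p⟫ < 0 := by
  have := h (-a) (hΦ.neg_mem a ha) (by simpa using h0)
  simpa using this

/-- Crossing a hyperplane does not increase the displacement, unless the images of the new chamber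
under `x` and its inverse both stay on the old side. -/
theorem disp_le_of_cross (hΦ : IsArrangement Φ x) (hp : Generic Φ p) (hq : Generic Φ q)
    {a : V} (ha : a ∈ Φ) (hap : ⟪a, p⟫ < 0) (haq : 0 < ⟪a, q⟫)
    (hpq : ∀ b ∈ Φ, b ≠ a → b ≠ -a → (0 < ⟪b, p⟫ ↔ 0 < ⟪b, q⟫))
    (h : x a = a ∨ x a = -a ∨ 0 < ⟪x a, p⟫ ∨ 0 < ⟪x.symm a, p⟫) :
    disp Φ x q ≤ disp Φ x p := by
  classical
  have hna := hΦ.neg_mem a ha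
  have hpn : ∀ b ∈ Φ, (⟪b, p⟫ < 0 ↔ ¬ 0 < ⟪b, p⟫) := fun b hb =>
    ⟨fun h => h.le.not_gt, fun h => lt_of_le_of_ne (not_lt.1 h) (hp b hb)⟩
  have hqn : ∀ b ∈ Φ, (⟪b, q⟫ < 0 ↔ ¬ 0 < ⟪b, q⟫) := fun b hb =>
    ⟨fun h => h.le.not_gt, fun h => lt_of_le_of_ne (not_lt.1 h) (hq b hb)⟩
  have hap' : 0 < ⟪-a, p⟫ := by simpa using hap
  have haq' : ¬ 0 < ⟪-a, q⟫ := by simpa using haq.le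
  have hap'' : ¬ 0 < ⟪a, p⟫ := hap.le.not_gt
  have mp : ∀ b, b ∈ Φ.filter (fun a => 0 < ⟪a, p⟫ ∧ ⟪a, x p⟫ < 0) ↔
      b ∈ Φ ∧ 0 < ⟪b, p⟫ ∧ ¬ 0 < ⟪x.symm b, p⟫ := by
    intro b
    rw [Finset.mem_filter, inner_map_eq_inner_symm]
    exact and_congr_right fun hb => and_congr_right fun _ => hpn _ (hΦ.symm_mem hb)
  have mq : ∀ b, b ∈ Φ.filter (fun a => 0 < ⟪a, q⟫ ∧ ⟪a, x q⟫ < 0) ↔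
      b ∈ Φ ∧ 0 < ⟪b, q⟫ ∧ ¬ 0 < ⟪x.symm b, q⟫ := by
    intro b
    rw [Finset.mem_filter, inner_map_eq_inner_symm]
    exact and_congr_right fun hb => and_congr_right fun _ => hqn _ (hΦ.symm_mem hb)
  unfold disp sep
  set F := Φ.filter (fun a => 0 < ⟪a, p⟫ ∧ ⟪a, x p⟫ < 0)
  set G := Φ.filter (fun a => 0 < ⟪a, q⟫ ∧ ⟪a, x q⟫ < 0)
  -- Only a and -x a can enter the count. When x a ≠ a, each case shows that at most one root b
  -- enters and that some root f leaves.
  have key : ∀ b f, G ⊆ insert b F → f ∈ F → f ∉ G → G.card ≤ F.card := by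
    intro b f h1 h2 h3
    have h4 : G ⊆ insert b (F.erase f) := by
      intro g hg
      have := h1 hg
      simp only [Finset.mem_insert, Finset.mem_erase] at this ⊢
      rcases this with h | h
      · exact Or.inl h
      · exact Or.inr ⟨fun e => h3 (e ▸ hg), h⟩
    calc G.card ≤ (insert b (F.erase f)).card := Finset.card_le_card h4
      _ ≤ (F.erase f).card + 1 := Finset.card_insert_le _ _
      _ = F.card := Finset.card_erase_add_one h2
  have hG : ∀ b ∈ G, b ∈ F ∨ b = a ∨ x.symm b = -a := by
    intro b hb
    obtain ⟨h1, h2, h3⟩ := (mq b).1 hb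
    by_cases e1 : b = a
    · exact Or.inr (Or.inl e1)
    by_cases e2 : x.symm b = -a
    · exact Or.inr (Or.inr e2)
    refine Or.inl ((mp b).2 ⟨h1, ?_, ?_⟩)
    · refine (hpq b h1 e1 ?_).2 h2
      rintro rfl; exact haq' h2
    · intro h4
      refine h3 ((hpq _ (hΦ.symm_mem h1) ?_ e2).1 h4)
      intro e; rw [e] at h4; exact hap'' h4
  have hsx : ∀ b, x.symm b = -a → b = -x a := by
    intro b hb
    rw [← map_neg, ← hb, x.apply_symm_apply]
  have hnG : -a ∉ G := fun h => haq' ((mq _).1 h).2.1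
  rcases h with h | h | h | h
  · have h' : x.symm a = a := (symm_eq_self_iff x a).2 h
    refine Finset.card_le_card fun b hb => ?_
    rcases hG b hb with h1 | rfl | h1
    · exact h1
    · have := ((mq _).1 hb).2.2
      rw [h'] at this; exact absurd haq this
    · have := hsx b h1
      rw [h] at this
      exact absurd (this ▸ hb) hnG
  · have h' : x.symm a = -a := (symm_eq_neg_iff x a).2 h
    refine key a (-a) (fun b hb => ?_) ((mp _).2 ⟨hna, hap', ?_⟩) hnG
    · rcases hG b hb with h1 | rfl | h1
      · exact Finset.mem_insert_of_mem h1
      · exact Finset.mem_insert_self _ _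
      · have := hsx b h1
        rw [h, neg_neg] at this
        simp [this]
    · rw [map_neg, h', neg_neg]; exact hap''
  · have e1 : x a ≠ a := by intro e; rw [e] at h; exact hap'' h
    by_cases e2 : x a = -a
    · have h' : x.symm a = -a := (symm_eq_neg_iff x a).2 e2
      refine key a (-a) (fun b hb => ?_) ((mp _).2 ⟨hna, hap', ?_⟩) hnG
      · rcases hG b hb with h1 | rfl | h1
        · exact Finset.mem_insert_of_mem h1
        · exact Finset.mem_insert_self _ _
        · have := hsx b h1
          rw [e2, neg_neg] at this
          simp [this]
      · rw [map_neg, h', neg_neg]; exact hap''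
    have hxq : 0 < ⟪x a, q⟫ := (hpq _ (hΦ.map_mem a ha) e1 e2).1 h
    refine key a (x a) (fun b hb => ?_) ((mp _).2 ⟨hΦ.map_mem a ha, h, by simpa using hap.le⟩) ?_
    · rcases hG b hb with h1 | rfl | h1
      · exact Finset.mem_insert_of_mem h1
      · exact Finset.mem_insert_self _ _
      · have h2 := hsx b h1
        have h3 := ((mq _).1 hb).2.1
        rw [h2, inner_neg_left] at h3
        linarith
    · intro hh
      have := ((mq _).1 hh).2.2
      rw [x.symm_apply_apply] at this
      exact this haq
  · have e1 : x.symm a ≠ a := by intro e; rw [e] at h; exact hap'' h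
    by_cases e2 : x.symm a = -a
    · have e3 : x a = -a := (symm_eq_neg_iff x a).1 e2
      refine key a (-a) (fun b hb => ?_) ((mp _).2 ⟨hna, hap', ?_⟩) hnG
      · rcases hG b hb with h1 | rfl | h1
        · exact Finset.mem_insert_of_mem h1
        · exact Finset.mem_insert_self _ _
        · have := hsx b h1
          rw [e3, neg_neg] at this
          simp [this]
      · rw [map_neg, e2, neg_neg]; exact hap''
    have hxq : 0 < ⟪x.symm a, q⟫ := (hpq _ (hΦ.symm_mem ha) e1 e2).1 h
    refine key (-x a) (-a) (fun b hb => ?_) ((mp _).2 ⟨hna, hap', ?_⟩) hnG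
    · rcases hG b hb with h1 | rfl | h1
      · exact Finset.mem_insert_of_mem h1
      · exact absurd hxq ((mq _).1 hb).2.2
      · rw [hsx b h1]; exact Finset.mem_insert_self _ _
    · rw [map_neg, inner_neg_left]; linarith

/-- A path meeting at most one hyperplane at a time, and crossing hyperplanes only in directions
that do not increase the displacement, gives a chain of chambers. -/
theorem exists_chain_of_path (hΦ : IsArrangement Φ x) {u : ℝ → V} (hu : Continuous u) {T : ℝ}
    (hT : 0 ≤ T)
    (hsub : ∀ t ∈ Icc 0 T, ∀ a ∈ Φ, ∀ b ∈ Φ, ⟪a, u t⟫ = 0 → ⟪b, u t⟫ = 0 → b = a ∨ b = -a)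
    (hcross : ∀ t ∈ Ico 0 T, ∀ a ∈ Φ, ⟪a, u t⟫ = 0 → 0 < ⟪a, x (u t)⟫ →
      0 < ⟪a, x.symm (u t)⟫ → ∀ᶠ s in 𝓝[>] t, 0 < ⟪a, u s⟫)
    (hp : Generic Φ p) (hup : Near Φ (u 0) p) :
    ∃ q, Generic Φ q ∧ Near Φ (u T) q ∧ Relation.ReflTransGen (Step Φ x) p q := by
  set S : Set ℝ := {t | ∃ q, Generic Φ q ∧ Near Φ (u t) q ∧
    Relation.ReflTransGen (Step Φ x) p q} with hS
  have hev : ∀ t, ∀ᶠ s in 𝓝 t, ∀ a ∈ Φ, (0 < ⟪a, u t⟫ → 0 < ⟪a, u s⟫) := by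
    intro t
    rw [Filter.eventually_all_finset]
    intro a _
    by_cases h : 0 < ⟪a, u t⟫
    · have : ContinuousAt (fun s => ⟪a, u s⟫) t := by fun_prop
      filter_upwards [this.eventually (lt_mem_nhds h)] with s hs _ using hs
    · exact Eventually.of_forall fun s h' => absurd h' h
  suffices h : Icc 0 T ⊆ S from h (right_mem_Icc.2 hT)
  refine IsClosed.Icc_subset_of_forall_exists_gt ?_ ⟨p, hp, hup, .refl⟩ ?_
  -- A strict inequality at u t persists at u s for s close to t, so a chamber near u s is also near
  -- u t.
  · refine isClosed_of_closure_subset fun t ht => ?_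
    have htI : t ∈ Icc 0 T := closure_minimal inter_subset_right isClosed_Icc ht
    refine ⟨?_, htI⟩
    obtain ⟨s, ⟨⟨q, hq, hqs, hc⟩, -⟩, h1⟩ :=
      ((mem_closure_iff_frequently.1 ht).and_eventually (hev t)).exists
    exact ⟨q, hq, fun a ha h => hqs a ha (h1 a ha h), hc⟩
  · rintro t ⟨⟨r, hr, hrt, hc⟩, ht⟩ y hy
    suffices h : ∀ᶠ s in 𝓝[>] t, s ∈ S by
      obtain ⟨s, h1, h2⟩ := (h.and (Ioc_mem_nhdsGT hy)).exists
      exact ⟨s, h1, h2⟩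
    have hev' := (hev t).filter_mono (nhdsWithin_le_nhds (s := Ioi t))
    have htI : t ∈ Icc 0 T := Ico_subset_Icc_self ht
    by_cases hg : Generic Φ (u t)
    · filter_upwards [hev'] with s hs
      refine ⟨r, hr, fun a ha h => ?_, hc⟩
      rcases hg.pos_or_neg ha with h1 | h1
      · exact hrt a ha h1
      · have := hs (-a) (hΦ.neg_mem a ha) (by simpa using h1)
        rw [inner_neg_left] at this
        linarith
    · obtain ⟨a, ha, ha0, har⟩ : ∃ a ∈ Φ, ⟪a, u t⟫ = 0 ∧ ⟪a, r⟫ < 0 := by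
        simp only [Generic, not_forall, not_not] at hg
        obtain ⟨a, ha, h0⟩ := hg
        rcases hr.pos_or_neg ha with h | h
        · exact ⟨-a, hΦ.neg_mem a ha, by simpa using h0, by simpa using h⟩
        · exact ⟨a, ha, h0, h⟩
      have hnear : ∀ s, (∀ a ∈ Φ, (0 < ⟪a, u t⟫ → 0 < ⟪a, u s⟫)) → ⟪a, u s⟫ ≤ 0 →
          Near Φ (u s) r := by
        intro s hs h1 b hb hbs
        rcases lt_trichotomy 0 ⟪b, u t⟫ with h | h | h
        · exact hrt b hb h
        · rcases hsub t htI a ha b hb ha0 h.symm with rfl | rfl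
          · linarith
          · simpa using har
        · have := hs (-b) (hΦ.neg_mem b hb) (by simpa using h)
          rw [inner_neg_left] at this
          linarith
      -- If both images are on the side of r, the crossing hypothesis for -a makes the path stay
      -- there. Otherwise the chamber across the wall can be reached without raising the
      -- displacement, and the path may continue on either side.
      by_cases hboth : ⟪a, x (u t)⟫ < 0 ∧ ⟪a, x.symm (u t)⟫ < 0
      · have := hcross t ht (-a) (hΦ.neg_mem a ha) (by simpa using ha0) (by simpa using hboth.1)
          (by simpa using hboth.2)
        filter_upwards [hev', this] with s hs h1
        exact ⟨r, hr, hnear s hs (by simpa using h1.le), hc⟩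
      obtain ⟨q, hq, hqt, haq⟩ : ∃ q, Generic Φ q ∧ Near Φ (u t) q ∧ 0 < ⟪a, q⟫ := by
        have : ∀ᶠ ε in 𝓝[>] (0 : ℝ), ∀ b ∈ Φ, 0 < ⟪b, u t⟫ → 0 < ⟪b, u t + ε • a⟫ := by
          rw [Filter.eventually_all_finset]
          intro b _
          by_cases h : 0 < ⟪b, u t⟫
          · have h1 : ContinuousAt (fun ε : ℝ => ⟪b, u t + ε • a⟫) 0 := by fun_prop
            have := h1.eventually (lt_mem_nhds (a := 0) (by simpa using h))
            filter_upwards [nhdsWithin_le_nhds this] with s hs _ using hs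
          · exact Eventually.of_forall fun s h' => absurd h' h
        obtain ⟨ε, h1, h2⟩ := (this.and self_mem_nhdsWithin).exists
        have h2 : 0 < ε := h2
        have haq : 0 < ⟪a, u t + ε • a⟫ := by
          rw [inner_add_right, ha0, inner_smul_right, real_inner_self_eq_norm_sq, hΦ.norm_eq a ha]
          simpa using h2
        refine ⟨u t + ε • a, fun b hb => ?_, h1, haq⟩
        rcases lt_trichotomy 0 ⟪b, u t⟫ with h | h | h
        · exact (h1 b hb h).ne'
        · rcases hsub t htI a ha b hb ha0 h.symm with rfl | rfl
          · exact haq.ne'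
          · rw [inner_neg_left]; linarith
        · have := h1 (-b) (hΦ.neg_mem b hb) (by simpa using h)
          rw [inner_neg_left] at this
          linarith
      have hrq : ∀ b ∈ Φ, b ≠ a → b ≠ -a → (0 < ⟪b, r⟫ ↔ 0 < ⟪b, q⟫) := by
        intro b hb h1 h2
        rcases lt_trichotomy 0 ⟪b, u t⟫ with h | h | h
        · exact iff_of_true (hrt b hb h) (hqt b hb h)
        · rcases hsub t htI a ha b hb ha0 h.symm with h | h <;> contradiction
        · exact iff_of_false (Near.neg hΦ hrt hb h).le.not_gt (Near.neg hΦ hqt hb h).le.not_gt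
      have hstep : Step Φ x r q := by
        refine ⟨hr, hq, disp_le_of_cross hΦ hr hq ha har haq hrq ?_, a, hrq⟩
        rw [inner_map_eq_inner_symm, inner_symm_eq_inner_map] at hboth
        by_contra! hcon
        obtain ⟨c1, c2, c3, c4⟩ := hcon
        refine hboth ⟨lt_of_le_of_ne ?_ ?_, lt_of_le_of_ne ?_ ?_⟩
        · exact not_lt.1 fun h => c4.not_gt (hrt _ (hΦ.symm_mem ha) h)
        · intro h
          rcases hsub t htI a ha _ (hΦ.symm_mem ha) ha0 h with h | h
          · exact c1 ((symm_eq_self_iff x a).1 h)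
          · exact c2 ((symm_eq_neg_iff x a).1 h)
        · exact not_lt.1 fun h => c3.not_gt (hrt _ (hΦ.map_mem a ha) h)
        · intro h
          rcases hsub t htI a ha _ (hΦ.map_mem a ha) ha0 h with h | h <;> contradiction
      filter_upwards [hev'] with s hs
      rcases le_or_gt ⟪a, u s⟫ 0 with h | h
      · exact ⟨r, hr, hnear s hs h, hc⟩
      · refine ⟨q, hq, fun b hb hbs => ?_, hc.tail hstep⟩
        rcases lt_trichotomy 0 ⟪b, u t⟫ with h' | h' | h'
        · exact hqt b hb h'
        · rcases hsub t htI a ha b hb ha0 h'.symm with rfl | rfl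
          · exact haq
          · rw [inner_neg_left] at hbs; linarith
        · have := hs (-b) (hΦ.neg_mem b hb) (by simpa using h')
          rw [inner_neg_left] at this
          linarith

end Arrangement

open Module

/-! ### General position by Hausdorff dimension. -/

section GenericPosition

theorem dimH_range_lt_finrank {E F : Type*} [NormedAddCommGroup E] [NormedSpace ℝ E]
    [NormedAddCommGroup F] [NormedSpace ℝ F]
    [FiniteDimensional ℝ F] {f : F → E} (hf : ContDiff ℝ 1 f)
    (h : finrank ℝ F < finrank ℝ E) : dimH (range f) < finrank ℝ E :=
  hf.dimH_range_le.trans_lt (by exact_mod_cast h)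

variable {E : Type*} [NormedAddCommGroup E] [NormedSpace ℝ E] [FiniteDimensional ℝ E]

/-- A finite union does not raise Hausdorff dimension above the maximum, and a set of dimension less
than that of the space has dense complement. Working with dimension covers the curved exceptional
sets swept out by the flow as well as subspaces. -/
theorem exists_mem_open_forall_notMem {ι : Type*} [Finite ι] {A : ι → Set E}
    (hA : ∀ i, dimH (A i) < finrank ℝ E) {U : Set E} (hU : IsOpen U) (hne : U.Nonempty) :
    ∃ p ∈ U, ∀ i, p ∉ A i := by
  rcases isEmpty_or_nonempty ι with h | ⟨⟨i₀⟩⟩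
  · exact hne.imp fun p hp => ⟨hp, fun i => (h.false i).elim⟩
  have : Fintype ι := Fintype.ofFinite ι
  have h1 : dimH (⋃ i, A i) < finrank ℝ E := by
    rw [dimH_iUnion, ← Finset.sup_univ_eq_iSup,
      Finset.sup_lt_iff (lt_of_le_of_lt bot_le (hA i₀))]
    exact fun i _ => hA i
  obtain ⟨p, hp, hpU⟩ := (dense_compl_of_dimH_lt_finrank h1).inter_open_nonempty U hU hne
  exact ⟨p, hp, fun i hi => hpU (mem_iUnion.2 ⟨i, hi⟩)⟩

theorem finrank_ker_inf_ker_add_two {f g : E →ₗ[ℝ] ℝ} (h : LinearIndependent ℝ ![f, g]) :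
    finrank ℝ ↥(LinearMap.ker f ⊓ LinearMap.ker g) + 2 = finrank ℝ E := by
  have : LinearMap.ker f ⊓ LinearMap.ker g =
      (Submodule.span ℝ (range ![f, g])).dualCoannihilator := by
    ext v
    rw [Submodule.mem_dualCoannihilator, Submodule.mem_inf, LinearMap.mem_ker, LinearMap.mem_ker]
    constructor
    · rintro ⟨h1, h2⟩ φ hφ
      induction hφ using Submodule.span_induction with
      | mem φ hφ =>
        obtain ⟨i, rfl⟩ := hφ
        fin_cases i <;> simpa
      | zero => rfl
      | add φ ψ _ _ h3 h4 => simp [h3, h4]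
      | smul c φ _ h3 => simp [h3]
    · intro hv
      exact ⟨hv f (Submodule.subset_span ⟨0, rfl⟩), hv g (Submodule.subset_span ⟨1, rfl⟩)⟩
  have h1 := Subspace.finrank_add_finrank_dualCoannihilator_eq
    (Submodule.span ℝ (range ![f, g]) : Submodule ℝ (Dual ℝ E))
  rw [finrank_span_eq_card h, Fintype.card_fin] at h1
  rw [this, ← h1, add_comm]

/-- The starting point of a segment can be moved slightly so that the segment avoids finitely many
subspaces of codimension at least two. -/
theorem exists_segment_avoiding {ι : Type*} [Finite ι] {S : ι → Submodule ℝ E}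
    (hS : ∀ i, finrank ℝ (S i) + 1 < finrank ℝ E) {U : Set E} (hU : IsOpen U) (hne : U.Nonempty)
    (q : E) : ∃ p ∈ U, ∀ t ∈ Ico (0 : ℝ) 1, ∀ i, (1 - t) • p + t • q ∉ S i := by
  -- A bad starting point lies on a line through q and a point of `S i`, and these lines fill the
  -- image of a space of dimension less than that of E. The parameter on the line is (1 - t)⁻¹, so t
  -- = 1 is excluded.
  let f : ∀ i, ℝ × S i → E := fun i z => q + z.1 • ((z.2 : E) - q)
  have hf : ∀ i, ContDiff ℝ 1 (f i) := fun i => by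
    have : ContDiff ℝ 1 (fun z : ℝ × S i => (z.2 : E)) :=
      (S i).subtypeL.contDiff.comp contDiff_snd
    exact contDiff_const.add (contDiff_fst.smul (this.sub contDiff_const))
  obtain ⟨p, hp, h⟩ := exists_mem_open_forall_notMem (A := fun i => range (f i))
    (fun i => dimH_range_lt_finrank (hf i) (by
      rw [finrank_prod, finrank_self]; have := hS i; omega)) hU hne
  refine ⟨p, hp, fun t ht i hi => h i ⟨((1 - t)⁻¹, ⟨_, hi⟩), ?_⟩⟩
  have : (1 - t) ≠ 0 := (sub_pos.2 ht.2).ne'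
  simp only [f]
  have h1 : (1 - t) • p + t • q - q = (1 - t) • (p - q) := by module
  rw [h1, smul_smul, inv_mul_cancel₀ this, one_smul, add_sub_cancel]

end GenericPosition

/-! ### The linear flow in an orthonormal eigenbasis. -/

section Flow

variable {E : Type*} [NormedAddCommGroup E] [InnerProductSpace ℝ E] {ι : Type*} [Fintype ι]

/-- The flow of the linear vector field with eigenbasis `b` and eigenvalues `μ`. -/
noncomputable def eigenFlow (b : OrthonormalBasis ι ℝ E) (μ : ι → ℝ) (t : ℝ) (v : E) : E :=
  ∑ i, (Real.exp (μ i * t) * ⟪b i, v⟫) • b i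

theorem eigenFlow_zero (b : OrthonormalBasis ι ℝ E) (μ : ι → ℝ) (v : E) :
    eigenFlow b μ 0 v = v := by
  simpa [eigenFlow] using b.sum_repr' v

theorem inner_basis_eigenFlow (b : OrthonormalBasis ι ℝ E) (μ : ι → ℝ) (t : ℝ) (v : E) (i : ι) :
    ⟪b i, eigenFlow b μ t v⟫ = Real.exp (μ i * t) * ⟪b i, v⟫ := by
  classical
  rw [eigenFlow, inner_sum, Finset.sum_eq_single i]
  · simp [inner_smul_right]
  · intro j _ hj
    rw [inner_smul_right, b.inner_eq_zero hj.symm, mul_zero]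
  · simp

theorem eigenFlow_neg_eigenFlow (b : OrthonormalBasis ι ℝ E) (μ : ι → ℝ) (t : ℝ) (v : E) :
    eigenFlow b μ (-t) (eigenFlow b μ t v) = v := by
  rw [← b.sum_repr' v]
  conv_lhs => rw [eigenFlow]
  refine Finset.sum_congr rfl fun i _ => ?_
  rw [b.sum_repr' v, inner_basis_eigenFlow, ← mul_assoc, ← Real.exp_add]
  simp

theorem contDiff_eigenFlow (b : OrthonormalBasis ι ℝ E) (μ : ι → ℝ) :
    ContDiff ℝ 1 (fun z : ℝ × E => eigenFlow b μ z.1 z.2) := by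
  unfold eigenFlow
  refine ContDiff.sum fun i _ => ContDiff.smul (ContDiff.mul ?_ ?_) contDiff_const
  · exact Real.contDiff_exp.comp (contDiff_const.mul contDiff_fst)
  · exact contDiff_const.inner ℝ contDiff_snd

theorem inner_eigenFlow (b : OrthonormalBasis ι ℝ E) (μ : ι → ℝ) (t : ℝ) (a v : E) :
    ⟪a, eigenFlow b μ t v⟫ = ∑ i, Real.exp (μ i * t) * (⟪b i, v⟫ * ⟪a, b i⟫) := by
  rw [eigenFlow, inner_sum]
  exact Finset.sum_congr rfl fun i _ => by rw [inner_smul_right, mul_assoc]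

/-- For L = x + x⁻¹ the derivative is ⟪a, x u⟫ + ⟪a, x⁻¹ u⟫, so on the hyperplane of a the flow
moves to the positive side when both terms are positive. This is the crossing hypothesis of
`exists_chain_of_path`. -/
theorem hasDerivAt_inner_eigenFlow (b : OrthonormalBasis ι ℝ E) (μ : ι → ℝ) {L : E → E}
    (hL : ∀ v w, ⟪v, L w⟫ = ⟪L v, w⟫) (hb : ∀ i, L (b i) = μ i • b i) (t : ℝ) (a v : E) :
    HasDerivAt (fun t => ⟪a, eigenFlow b μ t v⟫) ⟪a, L (eigenFlow b μ t v)⟫ t := by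
  have h1 : ⟪a, L (eigenFlow b μ t v)⟫ =
      ∑ i, (Real.exp (μ i * t) * (μ i * 1)) * (⟪b i, v⟫ * ⟪a, b i⟫) := by
    rw [← b.sum_inner_mul_inner]
    refine Finset.sum_congr rfl fun i _ => ?_
    rw [hL, hb, inner_smul_left, inner_basis_eigenFlow]
    simp only [conj_trivial]
    ring
  rw [h1]
  simp_rw [inner_eigenFlow]
  refine HasDerivAt.fun_sum fun i _ => HasDerivAt.mul_const ?_ _
  exact ((hasDerivAt_id t).const_mul (μ i)).exp

end Flow

/-! ### Eigenspaces of x + x⁻¹, and chains leading towards them. -/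

section Arrangement

variable {V : Type*} [NormedAddCommGroup V] [InnerProductSpace ℝ V]
variable {Φ : Finset V} {x : V ≃ₗᵢ[ℝ] V} {p q : V}

/-- The symmetric operator `x + x⁻¹`. -/
noncomputable def symmSum (x : V ≃ₗᵢ[ℝ] V) : V →ₗ[ℝ] V :=
  (x.toLinearEquiv : V →ₗ[ℝ] V) + (x.symm.toLinearEquiv : V →ₗ[ℝ] V)

@[simp] theorem symmSum_apply (x : V ≃ₗᵢ[ℝ] V) (v : V) : symmSum x v = x v + x.symm v := rfl

theorem isSymmetric_symmSum (x : V ≃ₗᵢ[ℝ] V) : (symmSum x).IsSymmetric := by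
  intro v w
  rw [symmSum_apply, symmSum_apply, inner_add_left, inner_add_right, inner_map_eq_inner_symm,
    inner_symm_eq_inner_map, add_comm]

/-- The points `v` with `x v + x⁻¹ v = c v`. -/
noncomputable def rotSpace (x : V ≃ₗᵢ[ℝ] V) (c : ℝ) : Submodule ℝ V :=
  LinearMap.ker (symmSum x - c • LinearMap.id)

theorem mem_rotSpace {c : ℝ} {v : V} : v ∈ rotSpace x c ↔ x v + x.symm v = c • v := by
  simp [rotSpace, sub_eq_zero]

theorem symm_mem_rotSpace {c : ℝ} {v : V} (h : v ∈ rotSpace x c) : x.symm v ∈ rotSpace x c := by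
  rw [mem_rotSpace] at h ⊢
  rw [← map_smul, ← h, map_add, x.apply_symm_apply, x.symm_apply_apply]

theorem two_mul_inner_map_self {c : ℝ} {v : V} (h : v ∈ rotSpace x c) :
    2 * ⟪x v, v⟫ = c * ‖v‖ ^ 2 := by
  have h1 : ⟪x v + x.symm v, v⟫ = c * ‖v‖ ^ 2 := by
    rw [mem_rotSpace.1 h, inner_smul_left, real_inner_self_eq_norm_sq]; rfl
  rw [← h1, inner_add_left, ← inner_map_eq_inner_symm, real_inner_comm v (x v)]
  ring

/-- On this space ‖x v - v‖² = (2 - c)‖v‖². The absence of relevant fixed points will thus force c <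
2. -/
theorem map_eq_self_of_mem_rotSpace {c : ℝ} {v : V} (h : v ∈ rotSpace x c) (hc : 2 ≤ c) :
    x v = v := by
  have h1 := two_mul_inner_map_self h
  have h2 := norm_sub_sq_real (x v) v
  rw [x.norm_map] at h2
  have : ‖x v - v‖ = 0 := by
    nlinarith [sq_nonneg ‖x v - v‖, mul_nonneg (sub_nonneg.2 hc) (sq_nonneg ‖v‖)]
  exact sub_eq_zero.1 (norm_eq_zero.1 this)

theorem map_eq_neg_of_mem_rotSpace {c : ℝ} {v : V} (h : v ∈ rotSpace x c) (hc : c ≤ -2) :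
    x v = -v := by
  have h1 := two_mul_inner_map_self h
  have h2 := norm_add_sq_real (x v) v
  rw [x.norm_map] at h2
  have : ‖x v + v‖ = 0 := by
    nlinarith [sq_nonneg ‖x v + v‖, mul_nonneg (sub_nonneg.2 hc) (sq_nonneg ‖v‖)]
  exact eq_neg_of_add_eq_zero_left (norm_eq_zero.1 this)

/-- Sign implications for a symmetric set of functionals can be reversed at generic points. -/
theorem pos_of_pos_of_forall_pos_imp (hΦ : IsArrangement Φ x) {P : V → Prop}
    (hP : ∀ a, P a → P (-a)) {u v : V} (hu : ∀ a ∈ Φ, P a → ⟪a, u⟫ ≠ 0)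
    (h : ∀ a ∈ Φ, P a → 0 < ⟪a, u⟫ → 0 < ⟪a, v⟫) {a : V} (ha : a ∈ Φ) (hPa : P a)
    (hv : 0 < ⟪a, v⟫) : 0 < ⟪a, u⟫ := by
  by_contra h1
  have h2 := h (-a) (hΦ.neg_mem a ha) (hP a hPa) (by
    rw [inner_neg_left, neg_pos]; exact lt_of_le_of_ne (not_lt.1 h1) (hu a ha hPa))
  rw [inner_neg_left] at h2
  linarith

theorem Near.iff (hΦ : IsArrangement Φ x) (hp : Generic Φ p) (h : Near Φ p q) {a : V}
    (ha : a ∈ Φ) : 0 < ⟪a, p⟫ ↔ 0 < ⟪a, q⟫ :=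
  ⟨h a ha, pos_of_pos_of_forall_pos_imp hΦ (P := fun _ => True) (fun _ _ => trivial)
    (fun a ha _ => hp a ha) (fun a ha _ => h a ha) ha trivial⟩

theorem Near.symm (hΦ : IsArrangement Φ x) (hp : Generic Φ p) (h : Near Φ p q) : Near Φ q p :=
  fun _ ha h1 => (h.iff hΦ hp ha).2 h1

theorem neg_iff_neg_of_pos_iff_pos {a : V} (hp : ⟪a, p⟫ ≠ 0) (hq : ⟪a, q⟫ ≠ 0)
    (h : 0 < ⟪a, p⟫ ↔ 0 < ⟪a, q⟫) : ⟪a, p⟫ < 0 ↔ ⟪a, q⟫ < 0 := by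
  rw [← not_iff_not, not_lt, not_lt, hp.symm.le_iff_lt, hq.symm.le_iff_lt, h]

theorem disp_congr (hΦ : IsArrangement Φ x) (hp : Generic Φ p) (hq : Generic Φ q)
    (h : ∀ a ∈ Φ, (0 < ⟪a, p⟫ ↔ 0 < ⟪a, q⟫)) : disp Φ x p = disp Φ x q := by
  classical
  unfold disp sep
  congr 1
  refine Finset.filter_congr fun a ha => and_congr (h a ha) ?_
  rw [inner_map_eq_inner_symm, inner_map_eq_inner_symm]
  exact neg_iff_neg_of_pos_iff_pos (hp _ (hΦ.symm_mem ha)) (hq _ (hΦ.symm_mem ha))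
    (h _ (hΦ.symm_mem ha))

theorem Step.of_near (hΦ : IsArrangement Φ x) (hp : Generic Φ p) (hq : Generic Φ q)
    (h : Near Φ p q) : Step Φ x p q :=
  ⟨hp, hq, (disp_congr hΦ hp hq fun _ ha => h.iff hΦ hp ha).ge, 0,
    fun _ hb _ _ => h.iff hΦ hp hb⟩

theorem Near.generic (hΦ : IsArrangement Φ x) (hp : Generic Φ p) (h : Near Φ p q) :
    Generic Φ q := by
  intro a ha
  rcases hp.pos_or_neg ha with h1 | h1
  · exact (h a ha h1).ne'
  · exact (h.neg hΦ ha h1).ne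

theorem isOpen_setOf_pos (Ψ : Finset V) : IsOpen {v : V | ∀ a ∈ Ψ, 0 < ⟪a, v⟫} := by
  have : {v : V | ∀ a ∈ Ψ, 0 < ⟪a, v⟫} = ⋂ a ∈ Ψ, {v | 0 < ⟪a, v⟫} := by ext; simp
  rw [this]
  exact isOpen_biInter_finset fun a _ => isOpen_lt continuous_const (by fun_prop)

/-- The points on the same side as `u` of all the hyperplanes not containing `u`. -/
theorem isOpen_setOf_near (Φ : Finset V) (u : V) : IsOpen {v : V | Near Φ u v} := by
  classical
  convert isOpen_setOf_pos (Φ.filter fun a => 0 < ⟪a, u⟫) using 1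
  ext v
  simp [Near]

theorem linearIndependent_inner_pair {a b : V} (ha : ‖a‖ = 1) (hb : ‖b‖ = 1) (h1 : b ≠ a)
    (h2 : b ≠ -a) :
    LinearIndependent ℝ ![(innerₛₗ ℝ a : V →ₗ[ℝ] ℝ), (innerₛₗ ℝ b : V →ₗ[ℝ] ℝ)] := by
  rw [LinearIndependent.pair_iff]
  intro s t h
  have h3 : s • a + t • b = 0 := by
    refine ext_inner_right ℝ fun v => ?_
    have := LinearMap.congr_fun h v
    simpa [inner_add_left, inner_smul_left] using this
  by_cases ht : t = 0
  · subst ht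
    have : a ≠ 0 := by rintro rfl; simp at ha
    simpa [this] using h3
  · exfalso
    have h4 : b = (-(s / t)) • a := by
      have : t • b = (-s) • a := by rw [neg_smul]; exact eq_neg_of_add_eq_zero_right h3
      rw [← inv_smul_smul₀ ht b, this, smul_smul]; congr 1; field_simp
    rw [h4, norm_smul, ha, mul_one, Real.norm_eq_abs] at hb
    rcases eq_or_eq_neg_of_abs_eq hb with h | h <;> rw [h] at h4
    · exact h1 (by simpa using h4)
    · exact h2 (by simpa using h4)

theorem mem_ker_inf_ker_iff {a b v : V} :
    v ∈ LinearMap.ker (innerₛₗ ℝ a : V →ₗ[ℝ] ℝ) ⊓ LinearMap.ker (innerₛₗ ℝ b : V →ₗ[ℝ] ℝ) ↔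
      ⟪a, v⟫ = 0 ∧ ⟪b, v⟫ = 0 := by
  simp

theorem inner_segment (a p q : V) (t : ℝ) :
    ⟪a, (1 - t) • p + t • q⟫ = (1 - t) * ⟪a, p⟫ + t * ⟪a, q⟫ := by
  rw [inner_add_right, inner_smul_right, inner_smul_right]

theorem inner_segment_pos {a p q : V} (hp : 0 < ⟪a, p⟫) (hq : 0 < ⟪a, q⟫) {t : ℝ}
    (ht : t ∈ Icc (0 : ℝ) 1) : 0 < ⟪a, (1 - t) • p + t • q⟫ := by
  rw [inner_segment]
  rcases ht.1.eq_or_lt with rfl | h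
  · simpa
  · exact add_pos_of_nonneg_of_pos (mul_nonneg (sub_nonneg.2 ht.2) hp.le) (mul_pos h hq)

section FiniteDimensional

variable [FiniteDimensional ℝ V]

/-- A segment between generic points can be put in general position. -/
theorem exists_segment_subregular (hΦ : IsArrangement Φ x) {U : Set V} (hU : IsOpen U)
    (hne : U.Nonempty) (hq : Generic Φ q) :
    ∃ p ∈ U, ∀ t ∈ Icc (0 : ℝ) 1, ∀ a ∈ Φ, ∀ b ∈ Φ, ⟪a, (1 - t) • p + t • q⟫ = 0 →
      ⟪b, (1 - t) • p + t • q⟫ = 0 → b = a ∨ b = -a := by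
  let ι := {z : Φ × Φ // (z.2 : V) ≠ z.1 ∧ (z.2 : V) ≠ -z.1}
  let S : ι → Submodule ℝ V := fun z =>
    LinearMap.ker (innerₛₗ ℝ (z.1.1 : V) : V →ₗ[ℝ] ℝ) ⊓
      LinearMap.ker (innerₛₗ ℝ (z.1.2 : V) : V →ₗ[ℝ] ℝ)
  obtain ⟨p, hp, h⟩ := exists_segment_avoiding (S := S) (fun z => by
    have := finrank_ker_inf_ker_add_two (linearIndependent_inner_pair
      (hΦ.norm_eq _ z.1.1.2) (hΦ.norm_eq _ z.1.2.2) z.2.1 z.2.2)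
    simp only [S]
    omega) hU hne q
  refine ⟨p, hp, fun t ht a ha b hb h1 h2 => ?_⟩
  by_contra! hcon
  rcases ht.2.eq_or_lt with rfl | ht1
  · exact hq a ha (by simpa using h1)
  · exact h t ⟨ht.1, ht1⟩ ⟨(⟨a, ha⟩, ⟨b, hb⟩), hcon⟩ (mem_ker_inf_ker_iff.2 ⟨h1, h2⟩)

/-- If `x` acts as `-1` on `Φ`, all chambers are connected by chains. -/
theorem exists_chain_of_map_eq_neg (hΦ : IsArrangement Φ x) (hx : ∀ a ∈ Φ, x a = -a)
    (hp : Generic Φ p) (hq : Generic Φ q) : Relation.ReflTransGen (Step Φ x) p q := by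
  obtain ⟨p', hp', hsub⟩ := exists_segment_subregular hΦ (isOpen_setOf_near Φ p)
    ⟨p, fun _ _ h => h⟩ hq
  obtain ⟨q', hq', hnear, hc⟩ := exists_chain_of_path hΦ
    (u := fun t : ℝ => (1 - t) • p' + t • q) (by fun_prop) zero_le_one hsub
    -- Vacuous: x⁻¹ a = -a, so x u lies on every root hyperplane that contains u.
    (fun t _ a ha h0 h1 => by
      rw [inner_map_eq_inner_symm, (symm_eq_neg_iff x a).2 (hx a ha), inner_neg_left, h0] at h1
      simp at h1) hp (by simpa using Near.symm hΦ hp hp')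
  simp only [sub_self, zero_smul, one_smul, zero_add] at hnear
  exact hc.tail (Step.of_near hΦ hq' hq (Near.symm hΦ hq hnear))

/-- A chain from any chamber to a chamber whose closure contains a regular point of the space where
the rotation angle of `x` is minimal. -/
theorem exists_chain_near_rotSpace {ι : Type*} [Fintype ι] (hΦ : IsArrangement Φ x)
    (b : OrthonormalBasis ι ℝ V) (μ : ι → ℝ) (hb : ∀ i, symmSum x (b i) = μ i • b i) {c : ℝ}
    (hc : ∀ i, ∀ a ∈ Φ, ⟪a, b i⟫ ≠ 0 → μ i ≤ c) (hp : Generic Φ p) :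
    ∃ k ∈ rotSpace x c, (∀ a ∈ Φ, a ∉ (rotSpace x c)ᗮ → ⟪a, k⟫ ≠ 0) ∧
      ∃ q, Generic Φ q ∧ Near Φ k q ∧ Relation.ReflTransGen (Step Φ x) p q := by
  classical
  -- The orthogonal projection onto `rotSpace x c`, written in the eigenbasis.
  let π : V →ₗ[ℝ] V :=
    ∑ i ∈ Finset.univ.filter (fun i => μ i = c), (innerₛₗ ℝ (b i) : V →ₗ[ℝ] ℝ).smulRight (b i)
  have hπ : ∀ v, π v = ∑ i ∈ Finset.univ.filter (fun i => μ i = c), ⟪b i, v⟫ • b i := by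
    intro v; simp [π]
  have hπ_mem : ∀ v, π v ∈ rotSpace x c := by
    intro v
    rw [hπ]
    refine Submodule.sum_mem _ fun i hi => Submodule.smul_mem _ _ ?_
    rw [mem_rotSpace, ← (Finset.mem_filter.1 hi).2, ← hb i, symmSum_apply]
  have hπ_self : ∀ k ∈ rotSpace x c, π k = k := by
    intro k hk
    rw [hπ]
    conv_rhs => rw [← b.sum_repr' k]
    refine Finset.sum_subset (Finset.filter_subset _ _) fun i _ hi => ?_
    have h1 : ⟪b i, symmSum x k⟫ = c * ⟪b i, k⟫ := by
      rw [symmSum_apply, mem_rotSpace.1 hk, inner_smul_right]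
    have h2 : ⟪b i, symmSum x k⟫ = μ i * ⟪b i, k⟫ := by
      rw [← isSymmetric_symmSum x, hb, inner_smul_left]; rfl
    have h3 : μ i ≠ c := by simpa using hi
    have : ⟪b i, k⟫ = 0 := by
      have : (μ i - c) * ⟪b i, k⟫ = 0 := by rw [sub_mul, ← h1, ← h2, sub_self]
      exact (mul_eq_zero.1 this).resolve_left (sub_ne_zero.2 h3)
    rw [this, zero_smul]
  let ι₁ := {z : Φ × Φ // (z.2 : V) ≠ z.1 ∧ (z.2 : V) ≠ -z.1}
  let ι₂ := {a : Φ // (a : V) ∉ (rotSpace x c)ᗮ}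
  let S : ι₁ → Submodule ℝ V := fun z =>
    LinearMap.ker (innerₛₗ ℝ (z.1.1 : V) : V →ₗ[ℝ] ℝ) ⊓
      LinearMap.ker (innerₛₗ ℝ (z.1.2 : V) : V →ₗ[ℝ] ℝ)
  let R : ι₂ → Submodule ℝ V := fun a =>
    LinearMap.ker ((innerₛₗ ℝ (a.1 : V) : V →ₗ[ℝ] ℝ).comp π)
  -- Starting points to avoid: those whose flow line meets two distinct hyperplanes at once, found
  -- by flowing the intersection backwards, and those whose projection lies on a hyperplane not
  -- containing `rotSpace x c`.
  let A : ι₁ ⊕ ι₂ → Set V := Sum.elim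
    (fun z => range fun w : ℝ × S z => eigenFlow b μ (-w.1) (w.2 : V))
    (fun a => range fun w : R a => (w : V))
  have hA : ∀ i, dimH (A i) < finrank ℝ V := by
    rintro (z | a)
    · refine dimH_range_lt_finrank ((contDiff_eigenFlow b μ).comp
        (contDiff_fst.neg.prodMk ((S z).subtypeL.contDiff.comp contDiff_snd))) ?_
      have := finrank_ker_inf_ker_add_two (linearIndependent_inner_pair
        (hΦ.norm_eq _ z.1.1.2) (hΦ.norm_eq _ z.1.2.2) z.2.1 z.2.2)
      rw [finrank_prod, finrank_self]
      simp only [S]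
      omega
    · refine dimH_range_lt_finrank (R a).subtypeL.contDiff (Submodule.finrank_lt ?_)
      intro htop
      have h0 : ∀ v, ⟪(a.1 : V), π v⟫ = 0 := fun v => by
        have : v ∈ R a := htop ▸ Submodule.mem_top
        simpa [R] using this
      refine a.2 ((Submodule.mem_orthogonal' _ _).2 fun k hk => ?_)
      rw [← hπ_self k hk]
      exact h0 k
  obtain ⟨p', hp', hav⟩ := exists_mem_open_forall_notMem hA (isOpen_setOf_near Φ p)
    ⟨p, fun _ _ h => h⟩
  have hreg : ∀ a ∈ Φ, a ∉ (rotSpace x c)ᗮ → ⟪a, π p'⟫ ≠ 0 := by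
    intro a ha hK h0
    exact hav (.inr ⟨⟨a, ha⟩, hK⟩) ⟨⟨p', by simpa [R] using h0⟩, rfl⟩
  -- The positive factor exp(-ct) changes no sign and makes the components with μ i < c decay; those
  -- with μ i > c are orthogonal to every root by `hc`.
  have hlim : ∀ a ∈ Φ, Tendsto (fun t => Real.exp (-(c * t)) * ⟪a, eigenFlow b μ t p'⟫) atTop
      (𝓝 ⟪a, π p'⟫) := by
    intro a ha
    have h1 : ⟪a, π p'⟫ = ∑ i, if μ i = c then ⟪b i, p'⟫ * ⟪a, b i⟫ else 0 := by
      rw [hπ, inner_sum, Finset.sum_filter]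
      exact Finset.sum_congr rfl fun i _ => by rw [inner_smul_right]
    rw [h1]
    simp_rw [inner_eigenFlow, Finset.mul_sum]
    refine tendsto_finsetSum _ fun i _ => ?_
    have h2 : ∀ t, Real.exp (-(c * t)) * (Real.exp (μ i * t) * (⟪b i, p'⟫ * ⟪a, b i⟫)) =
        Real.exp ((μ i - c) * t) * (⟪b i, p'⟫ * ⟪a, b i⟫) := by
      intro t
      rw [← mul_assoc, ← Real.exp_add]
      ring_nf
    simp_rw [h2]
    by_cases h0 : ⟪a, b i⟫ = 0
    · simp [h0]
    split_ifs with hi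
    · simp [hi]
    · have h3 : μ i - c < 0 := sub_neg.2 (lt_of_le_of_ne (hc i a ha h0) hi)
      have h4 := (Real.tendsto_exp_atBot.comp (tendsto_id.const_mul_atTop_of_neg h3)).mul_const
        (⟪b i, p'⟫ * ⟪a, b i⟫)
      simpa using h4
  obtain ⟨T, hT, hT0⟩ : ∃ T : ℝ, Near Φ (π p') (eigenFlow b μ T p') ∧ 0 ≤ T := by
    refine Eventually.exists (f := atTop) (Eventually.and ?_ (eventually_ge_atTop 0))
    refine (Filter.eventually_all_finset Φ).2 fun a ha => ?_
    by_cases h : 0 < ⟪a, π p'⟫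
    · filter_upwards [(hlim a ha).eventually (lt_mem_nhds h)] with t ht _
      exact (pos_iff_pos_of_mul_pos ht).1 (Real.exp_pos _)
    · exact Eventually.of_forall fun _ h' => absurd h' h
  have hcont : Continuous fun t => eigenFlow b μ t p' :=
    (contDiff_eigenFlow b μ).continuous.comp (continuous_id.prodMk continuous_const)
  obtain ⟨q, hq, hnear, hchain⟩ := exists_chain_of_path hΦ hcont hT0
    (fun t _ a ha a' ha' h1 h2 => by
      by_contra! hcon
      refine hav (.inl ⟨(⟨a, ha⟩, ⟨a', ha'⟩), hcon⟩)
        ⟨(t, ⟨eigenFlow b μ t p', mem_ker_inf_ker_iff.2 ⟨h1, h2⟩⟩), ?_⟩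
      exact eigenFlow_neg_eigenFlow b μ t p')
    (fun t _ a ha h0 h1 h2 => by
      have hd := hasDerivAt_inner_eigenFlow b μ (fun v w => (isSymmetric_symmSum x v w).symm) hb
        t a p'
      rw [symmSum_apply, inner_add_right] at hd
      have h3 := hd.tendsto_slope.eventually (lt_mem_nhds (add_pos h1 h2))
      have h4 : 𝓝[>] t ≤ 𝓝[≠] t := nhdsWithin_mono _ fun s hs => ne_of_gt hs
      filter_upwards [h4 h3, self_mem_nhdsWithin] with s hs hst
      rw [slope_def_field, h0, sub_zero] at hs
      exact (div_pos_iff_of_pos_right (sub_pos.2 hst)).1 hs)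
    hp (by
      rw [eigenFlow_zero]
      exact Near.symm hΦ hp hp')
  exact ⟨π p', hπ_mem p', hreg, q, hq, fun a ha h => hnear a ha (hT a ha h), hchain⟩

end FiniteDimensional

end Arrangement

/-! ### Chains along an eigenspace, and the induction on the arrangement. -/

section Arrangement

variable {V : Type*} [NormedAddCommGroup V] [InnerProductSpace ℝ V]
variable {Φ : Finset V} {x : V ≃ₗᵢ[ℝ] V} {p q : V}

/-- Testing a relation with coefficients s, t on k and on x⁻¹ k, where ⟪a, k⟫ ≠ 0, gives s² + t² +
cst = 0, and this form is definite for |c| < 2. Hence ⟪a, u⟫ = ⟪a, x u⟫ = 0 has codimension two in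
the eigenspace and a generic segment avoids it. -/
theorem linearIndependent_inner_rotSpace {c : ℝ} (hc : |c| < 2) {a : V}
    (ha : a ∉ (rotSpace x c)ᗮ) :
    LinearIndependent ℝ ![(innerₛₗ ℝ a : V →ₗ[ℝ] ℝ).comp (rotSpace x c).subtype,
      (innerₛₗ ℝ (x.symm a) : V →ₗ[ℝ] ℝ).comp (rotSpace x c).subtype] := by
  rw [LinearIndependent.pair_iff]
  intro s t h
  obtain ⟨k, hk, hak⟩ : ∃ k ∈ rotSpace x c, ⟪a, k⟫ ≠ 0 := by
    by_contra! hcon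
    exact ha ((Submodule.mem_orthogonal' _ _).2 hcon)
  have h1 : ∀ k ∈ rotSpace x c, s * ⟪a, k⟫ + t * ⟪a, x k⟫ = 0 := by
    intro k hk
    have := LinearMap.congr_fun h ⟨k, hk⟩
    rw [inner_map_eq_inner_symm]
    simpa using this
  have e1 := h1 k hk
  have e2 := h1 _ (symm_mem_rotSpace hk)
  rw [x.apply_symm_apply] at e2
  have e3 : ⟪a, x k⟫ + ⟪a, x.symm k⟫ = c * ⟪a, k⟫ := by
    rw [← inner_add_right, mem_rotSpace.1 hk, inner_smul_right]
  have e4 : (s ^ 2 + t ^ 2 + c * s * t) * ⟪a, k⟫ = 0 := by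
    linear_combination s * e1 + t * e2 - s * t * e3
  have e5 : s ^ 2 + t ^ 2 + c * s * t = 0 := (mul_eq_zero.1 e4).resolve_right hak
  obtain ⟨c1, c2⟩ := abs_lt.1 hc
  have e6 : (2 + c) * (s + t) ^ 2 + (2 - c) * (s - t) ^ 2 = 0 := by linear_combination 4 * e5
  have n1 : 0 ≤ (2 + c) * (s + t) ^ 2 := mul_nonneg (by linarith) (sq_nonneg _)
  have n2 : 0 ≤ (2 - c) * (s - t) ^ 2 := mul_nonneg (by linarith) (sq_nonneg _)
  have z1 : s + t = 0 := pow_eq_zero_iff two_ne_zero |>.1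
    ((mul_eq_zero.1 (by linarith : (2 + c) * (s + t) ^ 2 = 0)).resolve_left (by linarith))
  have z2 : s - t = 0 := pow_eq_zero_iff two_ne_zero |>.1
    ((mul_eq_zero.1 (by linarith : (2 - c) * (s - t) ^ 2 = 0)).resolve_left (by linarith))
  exact ⟨by linarith, by linarith⟩

theorem eventually_near_add_smul (Φ : Finset V) (k r : V) :
    ∀ᶠ ε in 𝓝[>] (0 : ℝ), Near Φ k (k + ε • r) := by
  have h1 : ContinuousAt (fun ε : ℝ => k + ε • r) 0 := by fun_prop
  refine nhdsWithin_le_nhds (h1.eventually ((isOpen_setOf_near Φ k).mem_nhds ?_))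
  show Near Φ k (k + (0 : ℝ) • r)
  rw [zero_smul, add_zero]
  exact fun a _ h => h

/-- A chain along the space where the rotation angle of `x` is minimal. -/
theorem exists_chain_along_rotSpace [FiniteDimensional ℝ V] (hΦ : IsArrangement Φ x) {c : ℝ} (hc : |c| < 2) {k k' : V}
    (hk : k ∈ rotSpace x c) (hk' : k' ∈ rotSpace x c)
    (hreg : ∀ a ∈ Φ, a ∉ (rotSpace x c)ᗮ → ⟪a, k⟫ ≠ 0)
    (hreg' : ∀ a ∈ Φ, a ∉ (rotSpace x c)ᗮ → ⟪a, k'⟫ ≠ 0) (hp : Generic Φ p) (hkp : Near Φ k p) :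
    ∃ q, Generic Φ q ∧ Near Φ k' q ∧
      (∀ a ∈ Φ, a ∈ (rotSpace x c)ᗮ → (0 < ⟪a, p⟫ ↔ 0 < ⟪a, q⟫)) ∧
      Relation.ReflTransGen (Step Φ x) p q := by
  set K := rotSpace x c with hK
  have hKneg : ∀ a : V, a ∉ Kᗮ → -a ∉ Kᗮ := fun a h h' => h (by simpa using Kᗮ.neg_mem h')
  have horth : ∀ a ∈ Kᗮ, ∀ u ∈ K, ⟪a, u⟫ = 0 := fun a ha u hu =>
    (Submodule.mem_orthogonal' _ _).1 ha u hu
  let ι := {a : Φ // (a : V) ∉ Kᗮ}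
  let S : ι → Submodule ℝ K := fun a =>
    LinearMap.ker ((innerₛₗ ℝ (a.1 : V) : V →ₗ[ℝ] ℝ).comp K.subtype) ⊓
      LinearMap.ker ((innerₛₗ ℝ (x.symm a.1) : V →ₗ[ℝ] ℝ).comp K.subtype)
  obtain ⟨k₁, hk₁, hseg⟩ := exists_segment_avoiding (S := S) (fun a => by
      have h : finrank ℝ (S a) + 2 = finrank ℝ K :=
        finrank_ker_inf_ker_add_two (linearIndependent_inner_rotSpace hc a.2)
      omega) ((isOpen_setOf_near Φ k).preimage continuous_subtype_val)
    ⟨⟨k, hk⟩, fun _ _ h => h⟩ ⟨k', hk'⟩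
  -- For u in K with ⟪a, u⟫ = 0, the numbers ⟪a, x u⟫ and ⟪a, x⁻¹ u⟫ add up to c⟪a, u⟫ = 0, so they
  -- have opposite signs unless both vanish. This strict condition is open, hence it survives
  -- pushing the segment slightly off K.
  let O : Set V := ⋂ a : ι, {u | ⟪(a.1 : V), u⟫ ≠ 0 ∨ ⟪(a.1 : V), x u⟫ * ⟪(a.1 : V), x.symm u⟫ < 0}
  have hO : IsOpen O := by
    refine isOpen_iInter_of_finite fun a => IsOpen.union ?_ ?_
    · exact isOpen_ne_fun (f := fun u => ⟪(a.1 : V), u⟫) (by fun_prop) continuous_const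
    · exact isOpen_lt (f := fun u => ⟪(a.1 : V), x u⟫ * ⟪(a.1 : V), x.symm u⟫) (by fun_prop)
        continuous_const
  have hsegO : (fun t : ℝ => (1 - t) • (k₁ : V) + t • k') '' Icc 0 1 ⊆ O := by
    rintro _ ⟨t, ht, rfl⟩
    refine mem_iInter.2 fun a => ?_
    show _ ≠ _ ∨ _
    by_contra! hcon
    obtain ⟨h0, h1⟩ := hcon
    rcases ht.2.eq_or_lt with rfl | ht1
    · exact hreg' a.1 a.1.2 a.2 (by simpa using h0)
    have hmem : (1 - t) • (k₁ : V) + t • k' ∈ K :=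
      K.add_mem (K.smul_mem _ k₁.2) (K.smul_mem _ hk')
    set u := (1 - t) • (k₁ : V) + t • k' with hu
    have h2 : ⟪(a.1 : V), x u⟫ + ⟪(a.1 : V), x.symm u⟫ = 0 := by
      rw [← inner_add_right, mem_rotSpace.1 hmem, inner_smul_right, h0, mul_zero]
    have h3 : ⟪(a.1 : V), x u⟫ = 0 := by
      rw [eq_neg_of_add_eq_zero_right h2] at h1
      nlinarith
    refine hseg t ⟨ht.1, ht1⟩ a (Submodule.mem_inf.2 ⟨?_, ?_⟩)
    · simpa [hu] using h0
    · rw [inner_map_eq_inner_symm] at h3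
      simpa [hu] using h3
  have hsegcont : Continuous fun t : ℝ => (1 - t) • (k₁ : V) + t • k' := by fun_prop
  obtain ⟨η, hη, hthick⟩ := (isCompact_Icc.image hsegcont).exists_thickening_subset_open hO hsegO
  have hev : ∀ᶠ ε in 𝓝[>] (0 : ℝ), ‖ε • p‖ < η := by
    have h1 : ContinuousAt (fun ε : ℝ => ‖ε • p‖) 0 := by fun_prop
    exact nhdsWithin_le_nhds (h1.eventually (gt_mem_nhds (by simpa using hη)))
  obtain ⟨ε, ⟨⟨hεη, hε1⟩, hε2⟩, hε⟩ := (((hev.and (eventually_near_add_smul Φ k₁ p)).and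
    (eventually_near_add_smul Φ k' p)).and self_mem_nhdsWithin).exists
  have hε : 0 < ε := hε
  have hreg₁ : ∀ a ∈ Φ, a ∉ Kᗮ → (0 < ⟪a, (k₁ : V)⟫ → 0 < ⟪a, k⟫) := fun a ha haK h =>
    pos_of_pos_of_forall_pos_imp hΦ hKneg hreg (fun a ha _ => hk₁ a ha) ha haK h
  have hreg₁' : ∀ a ∈ Φ, a ∉ Kᗮ → ⟪a, (k₁ : V)⟫ ≠ 0 := by
    intro a ha haK
    rcases lt_or_gt_of_ne (hreg a ha haK) with h | h
    · exact (Near.neg hΦ hk₁ ha h).ne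
    · exact (hk₁ a ha h).ne'
  have hgen : ∀ u ∈ K, (∀ a ∈ Φ, a ∉ Kᗮ → ⟪a, u⟫ ≠ 0) → Near Φ u (u + ε • p) →
      Generic Φ (u + ε • p) := by
    intro u hu hur hun a ha
    by_cases haK : a ∈ Kᗮ
    · rw [inner_add_right, horth a haK u hu, inner_smul_right, zero_add]
      exact mul_ne_zero hε.ne' (hp a ha)
    · rcases lt_or_gt_of_ne (hur a ha haK) with h | h
      · exact (hun.neg hΦ ha h).ne
      · exact (hun a ha h).ne'
  have hg1 := hgen k₁ k₁.2 hreg₁' hε1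
  have hg2 := hgen k' hk' hreg' hε2
  obtain ⟨p₁, ⟨hp₁, hdist⟩, hsub⟩ := exists_segment_subregular hΦ
    ((isOpen_setOf_near Φ ((k₁ : V) + ε • p)).inter (Metric.isOpen_ball (x := (k₁ : V)) (ε := η)))
    ⟨(k₁ : V) + ε • p, fun _ _ h => h, by simpa using hεη⟩ hg2
  have hp₁g : Generic Φ p₁ := Near.generic hΦ hg1 hp₁
  have hKp₁ : ∀ a ∈ Φ, a ∈ Kᗮ → (0 < ⟪a, p₁⟫ ↔ 0 < ⟪a, p⟫) := by
    intro a ha haK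
    rw [← Near.iff hΦ hg1 hp₁ ha, inner_add_right, horth a haK _ k₁.2, inner_smul_right, zero_add,
      mul_pos_iff_of_pos_left hε]
  have hK₂ : ∀ a ∈ Φ, a ∈ Kᗮ → (0 < ⟪a, k' + ε • p⟫ ↔ 0 < ⟪a, p⟫) := by
    intro a ha haK
    rw [inner_add_right, horth a haK _ hk', inner_smul_right, zero_add,
      mul_pos_iff_of_pos_left hε]
  have hstart : Near Φ p₁ p := by
    intro a ha h
    by_cases haK : a ∈ Kᗮ
    · exact (hKp₁ a ha haK).1 h
    · refine hkp a ha (hreg₁ a ha haK ?_)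
      exact pos_of_pos_of_forall_pos_imp hΦ hKneg hreg₁'
        (fun a ha _ h => hp₁ a ha (hε1 a ha h)) ha haK h
  obtain ⟨q, hq, hnear, hchain⟩ := exists_chain_of_path hΦ
    (u := fun t : ℝ => (1 - t) • p₁ + t • (k' + ε • p)) (by fun_prop) zero_le_one hsub
    -- Vacuous: a hyperplane containing K is never met, since both ends are on the side of p, and at
    -- any other hyperplane membership in O excludes equal signs.
    (fun t ht a ha h0 h1 h2 => by
      exfalso
      have htI : t ∈ Icc (0 : ℝ) 1 := Ico_subset_Icc_self ht
      by_cases haK : a ∈ Kᗮ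
      · rcases hp.pos_or_neg ha with h | h
        · exact (inner_segment_pos ((hKp₁ a ha haK).2 h) ((hK₂ a ha haK).2 h) htI).ne' h0
        · have hna := hΦ.neg_mem a ha
          have hnK := Kᗮ.neg_mem haK
          have h' : 0 < ⟪-a, p⟫ := by simpa using h
          have := inner_segment_pos ((hKp₁ _ hna hnK).2 h') ((hK₂ _ hna hnK).2 h') htI
          rw [inner_neg_left, h0] at this
          simp at this
      · have hmem : (1 - t) • p₁ + t • (k' + ε • p) ∈ O := by
          refine hthick (Metric.mem_thickening_iff.2 ⟨_, ⟨t, htI, rfl⟩, ?_⟩)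
          have hd : dist p₁ (k₁ : V) < η := hdist
          rw [dist_eq_norm] at hd ⊢
          have : (1 - t) • p₁ + t • (k' + ε • p) - ((1 - t) • (k₁ : V) + t • k') =
              (1 - t) • (p₁ - (k₁ : V)) + t • (ε • p) := by module
          rw [this]
          refine (convex_ball (0 : V) η) (x := p₁ - (k₁ : V)) (y := ε • p) ?_ ?_ (by linarith [ht.2])
            ht.1 (by ring) |> mem_ball_zero_iff.1
          · simpa using hd
          · simpa using hεη
        rcases mem_iInter.1 hmem ⟨⟨a, ha⟩, haK⟩ with h | h
        · exact h h0
        · exact (mul_pos h1 h2).not_gt h)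
    hp (by simpa using hstart)
  simp only [sub_self, zero_smul, one_smul, zero_add] at hnear
  refine ⟨q, hq, fun a ha h => hnear a ha (hε2 a ha h), fun a ha haK => ?_, hchain⟩
  rw [← hK₂ a ha haK]
  exact Near.iff hΦ hg2 hnear ha

-- Near a regular point k of K the roots not orthogonal to K keep their signs at k, and x respects
-- the splitting of the roots. The second term does not depend on z, so minimality passes to the
-- hyperplanes containing K.
open Classical in
theorem disp_eq_add_of_near (hΦ : IsArrangement Φ x) {c : ℝ} {k z : V}
    (hreg : ∀ a ∈ Φ, a ∉ (rotSpace x c)ᗮ → ⟪a, k⟫ ≠ 0) (hz : Near Φ k z) :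
    disp Φ x z = disp (Φ.filter (· ∈ (rotSpace x c)ᗮ)) x z +
      disp (Φ.filter (· ∉ (rotSpace x c)ᗮ)) x k := by
  unfold disp sep
  have hside : ∀ a ∈ Φ, a ∉ (rotSpace x c)ᗮ →
      (0 < ⟪a, z⟫ ↔ 0 < ⟪a, k⟫) ∧ (⟪a, z⟫ < 0 ↔ ⟪a, k⟫ < 0) := by
    intro a ha haK
    rcases lt_or_gt_of_ne (hreg _ ha haK) with h | h
    · have := hz.neg hΦ ha h
      exact ⟨iff_of_false this.le.not_gt h.le.not_gt, iff_of_true this h⟩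
    · have := hz _ ha h
      exact ⟨iff_of_true this h, iff_of_false this.le.not_gt h.le.not_gt⟩
  rw [← Finset.card_filter_add_card_filter_not (s := Φ.filter _) (· ∈ (rotSpace x c)ᗮ)]
  congr 1
  · rw [Finset.filter_comm]
  · rw [Finset.filter_comm]
    congr 1
    refine Finset.filter_congr fun a ha => ?_
    obtain ⟨ha, haK⟩ := Finset.mem_filter.1 ha
    have hK : x.symm a ∉ (rotSpace x c)ᗮ := fun h => haK <|
      (Submodule.mem_orthogonal' _ _).2 fun u hu => by
        rw [← x.apply_symm_apply a, ← inner_symm_eq_inner_map]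
        exact (Submodule.mem_orthogonal' _ _).1 h _ (symm_mem_rotSpace hu)
    rw [inner_map_eq_inner_symm, inner_map_eq_inner_symm, (hside a ha haK).1,
      (hside _ (hΦ.symm_mem ha) hK).2]

/-- From a minimum the displacement can neither rise nor drop, so every step is an equality and can
be read backwards. -/
theorem reflTransGen_step_symm {m : ℕ} (hm : ∀ r, Generic Φ r → m ≤ disp Φ x r)
    (hp : disp Φ x p ≤ m) (h : Relation.ReflTransGen (Step Φ x) p q) :
    Relation.ReflTransGen (Step Φ x) q p ∧ disp Φ x q ≤ m := by
  induction h with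
  | refl => exact ⟨.refl, hp⟩
  | tail _ h ih =>
    obtain ⟨h1, h2, h3, a, ha⟩ := h
    exact ⟨.head ⟨h2, h1, ih.2.trans (hm _ h2), a, fun b hb h h' => (ha b hb h h').symm⟩ ih.1,
      h3.trans ih.2⟩

/-- Any two chambers of minimal displacement are connected by a chain of such chambers, if all the
fixed points of `x` lie on all the hyperplanes. -/
theorem exists_chain_of_minimal [FiniteDimensional ℝ V] (hΦ : IsArrangement Φ x)
    (hfix : ∀ v, x v = v → ∀ a ∈ Φ, ⟪a, v⟫ = 0) (hp : Generic Φ p) (hq : Generic Φ q)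
    (hpm : ∀ r, Generic Φ r → disp Φ x p ≤ disp Φ x r)
    (hqm : ∀ r, Generic Φ r → disp Φ x q ≤ disp Φ x r) :
    Relation.ReflTransGen (Step Φ x) p q := by
  classical
  induction hn : Φ.card using Nat.strong_induction_on generalizing Φ p q with
  | _ n ih =>
  subst hn
  rcases Φ.eq_empty_or_nonempty with rfl | ⟨a₀, ha₀⟩
  · exact .single ⟨by simp [Generic], by simp [Generic], by simp [disp, sep], 0, by simp⟩
  let b := (isSymmetric_symmSum x).eigenvectorBasis rfl
  let μ := (isSymmetric_symmSum x).eigenvalues rfl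
  have hb : ∀ i, symmSum x (b i) = μ i • b i :=
    (isSymmetric_symmSum x).apply_eigenvectorBasis rfl
  have hbmem : ∀ i, b i ∈ rotSpace x (μ i) := fun i => mem_rotSpace.2 (hb i)
  -- The induction passes to roots that need not span V, so eigenvectors orthogonal to all of them
  -- must be ignored.
  let I := Finset.univ.filter fun i => ∃ a ∈ Φ, ⟪a, b i⟫ ≠ 0
  have hI : I.Nonempty := by
    by_contra hcon
    have h1 : ∀ i, ⟪b i, a₀⟫ = 0 := fun i => by
      by_contra h
      exact hcon ⟨i, Finset.mem_filter.2 ⟨Finset.mem_univ _, a₀, ha₀, by rwa [real_inner_comm]⟩⟩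
    have h2 := b.sum_repr' a₀
    simp only [h1, zero_smul, Finset.sum_const_zero] at h2
    have := hΦ.norm_eq a₀ ha₀
    simp [← h2] at this
  obtain ⟨i₀, hi₀, hmax⟩ := I.exists_max_image μ hI
  obtain ⟨a₁, ha₁, ha₁i⟩ := (Finset.mem_filter.1 hi₀).2
  set c := μ i₀ with hcdef
  have hcmax : ∀ i, ∀ a ∈ Φ, ⟪a, b i⟫ ≠ 0 → μ i ≤ c := fun i a ha h =>
    hmax i (Finset.mem_filter.2 ⟨Finset.mem_univ _, a, ha, h⟩)
  have hc2 : c < 2 := by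
    by_contra! h
    exact ha₁i (hfix _ (map_eq_self_of_mem_rotSpace (hbmem i₀) h) a₁ ha₁)
  rcases le_or_gt c (-2) with hcn | hcn
  · refine exists_chain_of_map_eq_neg hΦ (fun a ha => ?_) hp hq
    conv_lhs => rw [← b.sum_repr' a]
    conv_rhs => rw [← b.sum_repr' a]
    rw [map_sum, ← Finset.sum_neg_distrib]
    refine Finset.sum_congr rfl fun i _ => ?_
    by_cases h : ⟪a, b i⟫ = 0
    · rw [real_inner_comm] at h
      simp [h]
    · rw [map_smul, map_eq_neg_of_mem_rotSpace (hbmem i) ((hcmax i a ha h).trans hcn), smul_neg]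
  have hcabs : |c| < 2 := abs_lt.2 ⟨hcn, hc2⟩
  obtain ⟨k, hk, hreg, p₁, hp₁, hkp, hc1⟩ := exists_chain_near_rotSpace hΦ b μ hb hcmax hp
  obtain ⟨k', hk', hreg', q₁, hq₁, hkq, hc2⟩ := exists_chain_near_rotSpace hΦ b μ hb hcmax hq
  obtain ⟨p₂, hp₂, hkp₂, -, hc3⟩ :=
    exists_chain_along_rotSpace hΦ hcabs hk hk' hreg hreg' hp₁ hkp
  have hc4 := hc1.trans hc3
  obtain ⟨-, hp₂m⟩ := reflTransGen_step_symm hpm le_rfl hc4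
  obtain ⟨hc5, hq₁m⟩ := reflTransGen_step_symm hqm le_rfl hc2
  -- The two chambers left to join are both near k', so only hyperplanes containing K can separate
  -- them. The root a₁ is not orthogonal to K, so this arrangement is strictly smaller.
  refine (hc4.trans ?_).trans hc5
  set K := rotSpace x c with hK
  set Ψ := Φ.filter (· ∈ Kᗮ) with hΨ
  have hKx : ∀ a ∈ Kᗮ, x a ∈ Kᗮ := fun a ha => (Submodule.mem_orthogonal' _ _).2 fun u hu => by
    rw [← inner_symm_eq_inner_map]
    exact (Submodule.mem_orthogonal' _ _).1 ha _ (symm_mem_rotSpace hu)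
  have hΨΦ : ∀ a ∈ Ψ, a ∈ Φ := fun a ha => (Finset.mem_filter.1 ha).1
  have hΨarr : IsArrangement Ψ x := by
    refine ⟨fun a ha => hΦ.norm_eq a (hΨΦ a ha), fun a ha => ?_, fun a ha => ?_⟩
    · exact Finset.mem_filter.2 ⟨hΦ.neg_mem a (hΨΦ a ha), Kᗮ.neg_mem (Finset.mem_filter.1 ha).2⟩
    · exact Finset.mem_filter.2 ⟨hΦ.map_mem a (hΨΦ a ha), hKx a (Finset.mem_filter.1 ha).2⟩
  have hcard : Ψ.card < Φ.card := by
    refine Finset.card_lt_card (Finset.filter_ssubset.2 ⟨a₁, ha₁, fun h => ha₁i ?_⟩)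
    exact (Submodule.mem_orthogonal' _ _).1 h _ (hbmem i₀)
  -- The lift is k' + εr: k' decides the roots not orthogonal to K, and r the others.
  have hlift : ∀ r, Generic Ψ r → ∃ z, Generic Φ z ∧ Near Φ k' z ∧
      ∀ a ∈ Ψ, (0 < ⟪a, r⟫ ↔ 0 < ⟪a, z⟫) := by
    intro r hr
    obtain ⟨ε, h1, hε⟩ := ((eventually_near_add_smul Φ k' r).and self_mem_nhdsWithin).exists
    have hε : 0 < ε := hε
    have h2 : ∀ a ∈ Ψ, ⟪a, k' + ε • r⟫ = ε * ⟪a, r⟫ := fun a ha => by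
      rw [inner_add_right, (Submodule.mem_orthogonal' _ _).1 (Finset.mem_filter.1 ha).2 _ hk',
        inner_smul_right, zero_add]
    refine ⟨_, fun a ha => ?_, h1, fun a ha => by rw [h2 a ha, mul_pos_iff_of_pos_left hε]⟩
    by_cases haK : a ∈ Kᗮ
    · have : a ∈ Ψ := Finset.mem_filter.2 ⟨ha, haK⟩
      rw [h2 a this]
      exact mul_ne_zero hε.ne' (hr a this)
    · rcases lt_or_gt_of_ne (hreg' a ha haK) with h | h
      · exact (h1.neg hΦ ha h).ne
      · exact (h1 a ha h).ne'
  have hgenΨ : ∀ z, Generic Φ z → Generic Ψ z := fun z hz a ha => hz a (hΨΦ a ha)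
  have hdisp : ∀ z, Near Φ k' z → disp Φ x z = disp Ψ x z + disp (Φ.filter (· ∉ Kᗮ)) x k' :=
    fun z hz => disp_eq_add_of_near hΦ hreg' hz
  have hmin : ∀ z, Near Φ k' z → (∀ r, Generic Φ r → disp Φ x z ≤ disp Φ x r) →
      ∀ r, Generic Ψ r → disp Ψ x z ≤ disp Ψ x r := by
    intro z hz hzm r hr
    obtain ⟨w, hw, hkw, hwr⟩ := hlift r hr
    have h1 := hzm w hw
    rw [hdisp z hz, hdisp w hkw, ← disp_congr hΨarr hr (hgenΨ w hw) hwr] at h1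
    omega
  have hchain := ih Ψ.card hcard hΨarr (fun v hv a ha => hfix v hv a (hΨΦ a ha))
    (hgenΨ _ hp₂) (hgenΨ _ hq₁) (hmin p₂ hkp₂ fun r hr => hp₂m.trans (hpm r hr))
    (hmin q₁ hkq fun r hr => hq₁m.trans (hqm r hr)) rfl
  have hsame : ∀ z w, Near Φ k' z → Near Φ k' w → ∀ a ∈ Φ, a ∉ Kᗮ →
      (0 < ⟪a, z⟫ ↔ 0 < ⟪a, w⟫) := by
    intro z w hz hw a ha haK
    rcases lt_or_gt_of_ne (hreg' a ha haK) with h | h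
    · exact iff_of_false (hz.neg hΦ ha h).le.not_gt (hw.neg hΦ ha h).le.not_gt
    · exact iff_of_true (hz a ha h) (hw a ha h)
  have hlifted : ∀ r, Relation.ReflTransGen (Step Ψ x) p₂ r → ∀ z, Generic Φ z → Near Φ k' z →
      (∀ a ∈ Ψ, (0 < ⟪a, r⟫ ↔ 0 < ⟪a, z⟫)) → Relation.ReflTransGen (Step Φ x) p₂ z := by
    intro r hr
    induction hr with
    | refl =>
      intro z hz hkz h
      refine .single (Step.of_near hΦ hp₂ hz fun a ha h1 => ?_)
      by_cases haK : a ∈ Kᗮ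
      · exact (h a (Finset.mem_filter.2 ⟨ha, haK⟩)).1 h1
      · exact (hsame _ _ hkp₂ hkz a ha haK).1 h1
    | @tail r r' _ hs ihr =>
      intro z' hz' hkz' h'
      obtain ⟨hr, hr', hle, a, ha⟩ := hs
      obtain ⟨z, hz, hkz, h⟩ := hlift r hr
      refine (ihr z hz hkz h).tail ⟨hz, hz', ?_, a, fun b hb h1 h2 => ?_⟩
      · rw [hdisp z hkz, hdisp z' hkz', ← disp_congr hΨarr hr (hgenΨ z hz) h,
          ← disp_congr hΨarr hr' (hgenΨ z' hz') h']
        omega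
      · by_cases hbK : b ∈ Kᗮ
        · have hbΨ : b ∈ Ψ := Finset.mem_filter.2 ⟨hb, hbK⟩
          rw [← h b hbΨ, ← h' b hbΨ]
          exact ha b hbΨ h1 h2
        · exact hsame _ _ hkz hkz' b hb hbK
  exact hlifted q₁ hchain q₁ hq₁ hkq fun _ _ => Iff.rfl

end Arrangement

/-! ### Reflections in unit vectors. -/

section Reflections

variable {V : Type*} [NormedAddCommGroup V] [InnerProductSpace ℝ V]

theorem reflection_congr {K L : Submodule ℝ V} [K.HasOrthogonalProjection]
    [L.HasOrthogonalProjection] (h : K = L) : K.reflection = L.reflection := by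
  subst h; rfl

theorem span_singleton_neg (a : V) : (ℝ ∙ -a) = ℝ ∙ a := by
  rw [← neg_one_smul ℝ a, Submodule.span_singleton_smul_eq (by simp)]

theorem reflection_apply_of_norm {a : V} (ha : ‖a‖ = 1) (v : V) :
    (ℝ ∙ a)ᗮ.reflection v = v - (2 * ⟪a, v⟫) • a := by
  rw [Submodule.reflection_orthogonal_apply, Submodule.reflection_singleton_apply]
  simp [ha, two_smul, two_mul, add_smul]

theorem eq_or_eq_neg_of_eq_smul {a b : V} (ha : ‖a‖ = 1) (hb : ‖b‖ = 1) {t : ℝ}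
    (h : b = t • a) : b = a ∨ b = -a := by
  rw [h, norm_smul, ha, mul_one, Real.norm_eq_abs] at hb
  rcases eq_or_eq_neg_of_abs_eq hb with h' | h' <;> rw [h'] at h
  · exact .inl (by simpa using h)
  · exact .inr (by simpa using h)

theorem eq_or_eq_neg_of_reflection_eq {a b : V} (ha : ‖a‖ = 1) (hb : ‖b‖ = 1)
    (h : (ℝ ∙ a)ᗮ.reflection = (ℝ ∙ b)ᗮ.reflection) : b = a ∨ b = -a := by
  have h1 := congrArg (fun f => f b) h
  simp only [reflection_apply_of_norm ha, reflection_apply_of_norm hb,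
    real_inner_self_eq_norm_sq, hb] at h1
  refine eq_or_eq_neg_of_eq_smul ha hb (t := ⟪a, b⟫) ?_
  have h2 : (2 : ℝ) • b = (2 : ℝ) • (⟪a, b⟫ • a) := by
    rw [smul_smul]
    simpa using (sub_right_inj.1 h1).symm
  exact smul_right_injective V two_ne_zero h2

theorem conj_reflection {a : V} (ha : ‖a‖ = 1) (g : V ≃ₗᵢ[ℝ] V) :
    g * (ℝ ∙ a)ᗮ.reflection * g⁻¹ = (ℝ ∙ g a)ᗮ.reflection := by
  ext v
  have hga : ‖g a‖ = 1 := by rw [g.norm_map, ha]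
  rw [reflection_apply_of_norm hga]
  show g ((ℝ ∙ a)ᗮ.reflection (g.symm v)) = _
  rw [reflection_apply_of_norm ha, map_sub, map_smul, g.apply_symm_apply, inner_symm_eq_inner_map]

end Reflections

/-! ### Roots of a reflection representation and walls of the fundamental cone. -/

section Roots

variable {B W : Type*} [Group W] {M : CoxeterMatrix B} {cs : CoxeterSystem M W}
variable {V : Type*} [NormedAddCommGroup V] [InnerProductSpace ℝ V]

/-- A unit vector orthogonal to a reflection hyperplane of the group. -/
def IsRoot (r : W →* (V ≃ₗᵢ[ℝ] V)) (a : V) : Prop :=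
  ‖a‖ = 1 ∧ ∃ w, r w = (ℝ ∙ a)ᗮ.reflection

/-- An action of a Coxeter group by isometries where the simple reflections act as reflections with
unit roots `e i`, and no reflection hyperplane meets the nonempty cone defined by these roots. -/
structure IsReflectionRep (cs : CoxeterSystem M W) (r : W →* (V ≃ₗᵢ[ℝ] V)) (e : B → V) (c : V) :
    Prop where
  injective : Function.Injective r
  norm_eq : ∀ i, ‖e i‖ = 1
  map_simple : ∀ i, r (cs.simple i) = (ℝ ∙ e i)ᗮ.reflection
  pos : ∀ i, 0 < ⟪e i, c⟫
  inner_ne_zero : ∀ a, IsRoot r a → ∀ v, (∀ i, 0 < ⟪e i, v⟫) → ⟪a, v⟫ ≠ 0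

theorem IsRoot.neg {r : W →* (V ≃ₗᵢ[ℝ] V)} {a : V} (h : IsRoot r a) : IsRoot r (-a) := by
  refine ⟨by rw [norm_neg, h.1], h.2.imp fun w hw => ?_⟩
  exact hw.trans (reflection_congr (by rw [span_singleton_neg]))

theorem IsRoot.map {r : W →* (V ≃ₗᵢ[ℝ] V)} {a : V} (h : IsRoot r a) {g : V ≃ₗᵢ[ℝ] V}
    (hg : ∀ w, ∃ w', g * r w * g⁻¹ = r w') : IsRoot r (g a) := by
  obtain ⟨h1, w, hw⟩ := h
  obtain ⟨w', hw'⟩ := hg w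
  exact ⟨by rw [g.norm_map, h1], w', by rw [← hw', hw, conj_reflection h1]⟩

theorem IsRoot.map_apply {r : W →* (V ≃ₗᵢ[ℝ] V)} {a : V} (h : IsRoot r a) (w : W) :
    IsRoot r (r w a) :=
  h.map fun w' => ⟨w * w' * w⁻¹, by simp⟩

/-- A reflection determines its unit normal up to sign, so each group element contributes at most
two roots. -/
theorem finite_setOf_isRoot [Finite W] (r : W →* (V ≃ₗᵢ[ℝ] V)) : {a : V | IsRoot r a}.Finite := by
  have h1 : {a : V | IsRoot r a} ⊆ ⋃ w : W, {a | ‖a‖ = 1 ∧ r w = (ℝ ∙ a)ᗮ.reflection} :=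
    fun a ⟨h1, w, hw⟩ => mem_iUnion.2 ⟨w, h1, hw⟩
  refine (finite_iUnion fun w => ?_).subset h1
  rcases Set.eq_empty_or_nonempty {a : V | ‖a‖ = 1 ∧ r w = (ℝ ∙ a)ᗮ.reflection} with h | ⟨a, ha⟩
  · rw [h]; exact finite_empty
  · refine (Set.toFinite {a, -a}).subset fun b hb => ?_
    exact eq_or_eq_neg_of_reflection_eq ha.1 hb.1 (ha.2.symm.trans hb.2)

/-- The finite set of roots. -/
noncomputable def roots [Finite W] (r : W →* (V ≃ₗᵢ[ℝ] V)) : Finset V :=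
  (finite_setOf_isRoot r).toFinset

theorem mem_roots [Finite W] {r : W →* (V ≃ₗᵢ[ℝ] V)} {a : V} : a ∈ roots r ↔ IsRoot r a := by
  simp [roots]

theorem inner_map_left (r : W →* (V ≃ₗᵢ[ℝ] V)) (w : W) (a v : V) :
    ⟪r w a, v⟫ = ⟪a, r w⁻¹ v⟫ := by
  rw [map_inv]
  exact (inner_symm_eq_inner_map (r w) a v).symm

theorem map_mul_apply (r : W →* (V ≃ₗᵢ[ℝ] V)) (w w' : W) (v : V) :
    r (w * w') v = r w (r w' v) := by
  rw [map_mul]; rfl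

theorem map_inv_map_apply (r : W →* (V ≃ₗᵢ[ℝ] V)) (w : W) (v : V) : r w⁻¹ (r w v) = v := by
  rw [← map_mul_apply, inv_mul_cancel, map_one]; rfl

theorem map_map_inv_apply (r : W →* (V ≃ₗᵢ[ℝ] V)) (w : W) (v : V) : r w (r w⁻¹ v) = v := by
  rw [← map_mul_apply, mul_inv_cancel, map_one]; rfl

namespace IsReflectionRep

variable {r : W →* (V ≃ₗᵢ[ℝ] V)} {e : B → V} {c : V}

theorem isRoot (h : IsReflectionRep cs r e c) (i : B) : IsRoot r (e i) :=
  ⟨h.norm_eq i, _, h.map_simple i⟩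

theorem simple_apply (h : IsReflectionRep cs r e c) (i : B) (v : V) :
    r (cs.simple i) v = v - (2 * ⟪e i, v⟫) • e i := by
  rw [h.map_simple, reflection_apply_of_norm (h.norm_eq i)]

theorem inner_simple_apply_self (h : IsReflectionRep cs r e c) (i : B) (v : V) :
    ⟪e i, r (cs.simple i) v⟫ = -⟪e i, v⟫ := by
  rw [h.simple_apply, inner_sub_right, inner_smul_right, real_inner_self_eq_norm_sq, h.norm_eq]
  ring

theorem ne_neg (h : IsReflectionRep cs r e c) (i j : B) : e j ≠ -e i := by
  intro he
  have := h.pos j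
  rw [he, inner_neg_left] at this
  linarith [h.pos i]

/-- The reflection of the free vector space on `V` covering the simple reflection `s i`. -/
noncomputable def freeReflection (e : B → V) (i : B) : Module.End ℝ (V →₀ ℝ) :=
  LinearMap.id - (((2 : ℝ) • (innerₛₗ ℝ (e i) : V →ₗ[ℝ] ℝ)).comp
    (Finsupp.linearCombination ℝ (id : V → V))).smulRight (Finsupp.single (e i) 1)

theorem freeReflection_apply (e : B → V) (i : B) (v : V →₀ ℝ) :
    freeReflection e i v = v - (2 * ⟪e i, Finsupp.linearCombination ℝ (id : V → V) v⟫) •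
      Finsupp.single (e i) (1 : ℝ) := by
  simp [freeReflection]

/-- Independence of the simple roots in V is not known here; in the free space they become basis
vectors, so supports make sense. The Coxeter relation survives because (s_i s_j)^m v - v is a
combination of the basis vectors of e i and e j with image 0 in V, where e i and e j are equal or
independent. -/
theorem isLiftable_freeReflection (h : IsReflectionRep cs r e c) :
    M.IsLiftable (freeReflection e) := by
  intro i j
  set π := Finsupp.linearCombination ℝ (id : V → V) with hπ
  have hπF : ∀ i v, π (freeReflection e i v) = r (cs.simple i) (π v) := by
    intro i v
    rw [freeReflection_apply, h.simple_apply, map_sub, map_smul]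
    simp [hπ]
  have h1 : ∀ n v, π (((freeReflection e i * freeReflection e j) ^ n) v) =
      r ((cs.simple i * cs.simple j) ^ n) (π v) := by
    intro n
    induction n with
    | zero => intro v; simp
    | succ n ih =>
      intro v
      rw [pow_succ', pow_succ', Module.End.mul_apply, Module.End.mul_apply, hπF, hπF, ih,
        ← map_mul_apply, ← map_mul_apply, mul_assoc]
  have h2 : ∀ n v, ∃ s t : ℝ, ((freeReflection e i * freeReflection e j) ^ n) v =
      v + s • Finsupp.single (e i) 1 + t • Finsupp.single (e j) 1 := by
    intro n
    induction n with
    | zero => intro v; exact ⟨0, 0, by simp⟩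
    | succ n ih =>
      intro v
      obtain ⟨s, t, hst⟩ := ih v
      rw [pow_succ', Module.End.mul_apply, hst, Module.End.mul_apply]
      set u := v + s • Finsupp.single (e i) (1 : ℝ) + t • Finsupp.single (e j) (1 : ℝ)
      rw [freeReflection_apply e i, freeReflection_apply e j]
      set α : ℝ := 2 * ⟪e j, Finsupp.linearCombination ℝ (id : V → V) u⟫
      generalize 2 * ⟪e i, Finsupp.linearCombination ℝ (id : V → V)
        (u - α • Finsupp.single (e j) 1)⟫ = β
      refine ⟨s - β, t - α, ?_⟩
      simp only [u]
      module
  refine LinearMap.ext fun v => ?_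
  obtain ⟨s, t, hst⟩ := h2 (M i j) v
  have h3 := h1 (M i j) v
  rw [cs.simple_mul_simple_pow, hst, map_one] at h3
  have h4 : s • e i + t • e j = 0 := by
    have h5 : π (v + s • Finsupp.single (e i) 1 + t • Finsupp.single (e j) 1) =
        π v + (s • e i + t • e j) := by
      simp [hπ, add_assoc]
    rw [h5] at h3
    simpa using h3
  rw [hst, Module.End.one_apply]
  by_cases hij : e j = e i
  · rw [hij, ← add_smul] at h4
    have hne : e i ≠ 0 := fun h0 => by have := h.norm_eq i; simp [h0] at this
    have := (smul_eq_zero.1 h4).resolve_right hne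
    rw [hij, add_assoc, ← add_smul, this, zero_smul, add_zero]
  · have hli := LinearIndependent.pair_iff.1
      (linearIndependent_inner_pair (h.norm_eq i) (h.norm_eq j) hij (h.ne_neg i j)) s t (by
        refine LinearMap.ext fun w => ?_
        have : ⟪s • e i + t • e j, w⟫ = 0 := by rw [h4, inner_zero_left]
        simpa [inner_add_left, inner_smul_left] using this)
    rw [hli.1, hli.2]
    simp

/-- A simple reflection lying in a standard parabolic subgroup is one of its generators. -/
theorem mem_of_simple_mem_closure (h : IsReflectionRep cs r e c) {D : Set V} {i : B}
    (hi : cs.simple i ∈ Subgroup.closure (cs.simple '' {j | e j ∈ D})) : e i ∈ D := by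
  let F := cs.lift ⟨_, h.isLiftable_freeReflection⟩
  have hF : ∀ j, F (cs.simple j) = freeReflection e j := cs.lift_apply_simple _
  -- Elements of the parabolic subgroup change only coordinates in D, while s i negates the basis
  -- vector of e i.
  have key : ∀ w ∈ Subgroup.closure (cs.simple '' {j | e j ∈ D}), ∀ v,
      F w v - v ∈ Finsupp.supported ℝ ℝ D := by
    intro w hw
    induction hw using Subgroup.closure_induction with
    | mem w hw =>
      obtain ⟨j, hj, rfl⟩ := hw
      intro v
      rw [hF, freeReflection_apply, sub_sub_cancel_left]
      exact Submodule.neg_mem _ (Submodule.smul_mem _ _ (Finsupp.single_mem_supported ℝ 1 hj))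
    | one => intro v; simp
    | mul w w' _ _ h1 h2 =>
      intro v
      rw [map_mul, Module.End.mul_apply, ← sub_add_sub_cancel _ (F w' v)]
      exact Submodule.add_mem _ (h1 _) (h2 v)
    | inv w _ h1 =>
      intro v
      have h2 : F w (F w⁻¹ v) = v := by
        rw [← Module.End.mul_apply, ← map_mul, mul_inv_cancel, map_one, Module.End.one_apply]
      have := Submodule.neg_mem _ (h1 (F w⁻¹ v))
      rwa [h2, neg_sub] at this
  have h1 := key _ hi (Finsupp.single (e i) 1)
  rw [hF, freeReflection_apply, sub_sub_cancel_left, Finsupp.linearCombination_single, one_smul,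
    id_eq, real_inner_self_eq_norm_sq, h.norm_eq] at h1
  have h2 := (Submodule.smul_mem_iff _ (by norm_num : (2 * (1 : ℝ) ^ 2) ≠ 0)).1
    ((Submodule.neg_mem_iff _).1 h1)
  exact (Finsupp.mem_supported ℝ _).1 h2 (by simp)

/-- Every point can be moved to the closed cone of some of the simple roots. -/
theorem exists_dominant [Finite W] (h : IsReflectionRep cs r e c) (H : Subgroup W) {D : Set V}
    (hH : ∀ j, e j ∈ D → cs.simple j ∈ H) (v : V) :
    ∃ w ∈ H, ∀ j, e j ∈ D → 0 ≤ ⟪e j, r w v⟫ := by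
  -- Applying s j changes the pairing with c by -2⟪e j, r w v⟫⟪e j, c⟫, which cannot be positive at
  -- a maximum.
  obtain ⟨⟨w, hw⟩, hmax⟩ := Finite.exists_max (fun w : H => ⟪r w v, c⟫)
  refine ⟨w, hw, fun j hj => ?_⟩
  have h1 := hmax ⟨cs.simple j * w, H.mul_mem (hH j hj) hw⟩
  simp only [map_mul_apply, h.simple_apply, inner_sub_left, inner_smul_left, conj_trivial] at h1
  have h2 : 0 ≤ ⟪e j, r w v⟫ * ⟪e j, c⟫ := by linarith
  exact nonneg_of_mul_nonneg_left h2 (h.pos j)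

theorem exists_pos [Finite W] (h : IsReflectionRep cs r e c) {v : V} (hv : Generic (roots r) v) :
    ∃ w, ∀ j, 0 < ⟪e j, r w v⟫ := by
  obtain ⟨w, -, hw⟩ := h.exists_dominant ⊤ (D := univ) (fun _ _ => Subgroup.mem_top _) v
  refine ⟨w, fun j => lt_of_le_of_ne (hw j trivial) fun h0 => ?_⟩
  refine hv (r w⁻¹ (e j)) (mem_roots.2 ((h.isRoot j).map_apply _)) ?_
  rw [inner_map_left, inv_inv, ← h0]

/-- A root does not change sign on the open cone. -/
theorem pos_iff_pos (h : IsReflectionRep cs r e c) {a : V} (ha : IsRoot r a) {p q : V}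
    (hp : ∀ i, 0 < ⟪e i, p⟫) (hq : ∀ i, 0 < ⟪e i, q⟫) : 0 < ⟪a, p⟫ ↔ 0 < ⟪a, q⟫ := by
  have key : ∀ p q : V, (∀ i, 0 < ⟪e i, p⟫) → (∀ i, 0 < ⟪e i, q⟫) → 0 < ⟪a, p⟫ → 0 < ⟪a, q⟫ := by
    intro p q hp hq h1
    by_contra! h2
    have h3 := lt_of_le_of_ne h2 (h.inner_ne_zero a ha q hq)
    refine h.inner_ne_zero a ha (⟪a, p⟫ • q + (-⟪a, q⟫) • p) (fun i => ?_) ?_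
    · rw [inner_add_right, inner_smul_right, inner_smul_right]
      exact add_pos (mul_pos h1 (hq i)) (mul_pos (neg_pos.2 h3) (hp i))
    · rw [inner_add_right, inner_smul_right, inner_smul_right]
      ring
  exact ⟨key p q hp hq, key q p hq hp⟩

/-- The hyperplane of each simple root is a wall of the cone. -/
theorem exists_wall_point [Finite W] (h : IsReflectionRep cs r e c) (i : B) :
    ∃ p, ⟪e i, p⟫ = 0 ∧ (∀ j, e j ≠ e i → 0 < ⟪e j, p⟫) ∧
      ∀ a, IsRoot r a → ⟪a, p⟫ = 0 → a = e i ∨ a = -e i := by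
  classical
  have hfin : (range e).Finite :=
    (finite_setOf_isRoot r).subset (range_subset_iff.2 h.isRoot)
  -- A minimal set D of simple roots cutting out the same cone consists of genuine walls. That D
  -- contains every simple root follows by showing that its reflections generate all reflections and
  -- applying `mem_of_simple_mem_closure`.
  let P : Finset V → Prop := fun D => (D : Set V) ⊆ range e ∧
    ∀ v, (∀ a ∈ D, 0 < ⟪a, v⟫) → ∀ i, 0 < ⟪e i, v⟫
  obtain ⟨D, -, hDP, hDmin⟩ := exists_minimal_le_of_wellFoundedLT P hfin.toFinset
    ⟨by simp, fun v hv i => hv _ (by simp)⟩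
  have hwall : ∀ a ∈ D, ∃ p, ⟪a, p⟫ = 0 ∧ (∀ b ∈ D, b ≠ a → 0 < ⟪b, p⟫) ∧
      ∀ a', IsRoot r a' → ⟪a', p⟫ = 0 → a' = a ∨ a' = -a := by
    intro a ha
    have hpos : ∀ b ∈ D, 0 < ⟪b, c⟫ := fun b hb => by
      obtain ⟨j, rfl⟩ := hDP.1 hb
      exact h.pos j
    have hnorm : ‖a‖ = 1 := by
      obtain ⟨j, rfl⟩ := hDP.1 ha
      exact h.norm_eq j
    obtain ⟨v, hv, hav⟩ : ∃ v, (∀ b ∈ D.erase a, 0 < ⟪b, v⟫) ∧ ⟪a, v⟫ ≤ 0 := by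
      by_contra! hcon
      have h1 : P (D.erase a) := by
        refine ⟨fun b hb => hDP.1 (Finset.mem_of_mem_erase hb), fun v hv => hDP.2 v fun b hb => ?_⟩
        by_cases hba : b = a
        · rw [hba]; exact hcon v hv
        · exact hv b (Finset.mem_erase.2 ⟨hba, hb⟩)
      exact Finset.notMem_erase a D (hDmin h1 (Finset.erase_subset a D) ha)
    -- A positive multiple of the point where the segment from c to v meets the hyperplane of a.
    set p := ⟪a, c⟫ • v + (-⟪a, v⟫) • c with hp
    have hp0 : ⟪a, p⟫ = 0 := by
      rw [hp, inner_add_right, inner_smul_right, inner_smul_right]; ring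
    have hppos : ∀ b ∈ D, b ≠ a → 0 < ⟪b, p⟫ := by
      intro b hb hba
      rw [hp, inner_add_right, inner_smul_right, inner_smul_right]
      exact add_pos_of_pos_of_nonneg (mul_pos (hpos a ha) (hv b (Finset.mem_erase.2 ⟨hba, hb⟩)))
        (mul_nonneg (neg_nonneg.2 hav) (hpos b hb).le)
    refine ⟨p, hp0, hppos, fun a' ha' h0 => ?_⟩
    by_contra! hcon
    -- Moving from p along the part of a orthogonal to a' stays on the hyperplane of a' and enters
    -- the open cone, which no reflection hyperplane meets.
    set u := a - ⟪a', a⟫ • a' with hu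
    have hu0 : ⟪a', u⟫ = 0 := by
      rw [hu, inner_sub_right, inner_smul_right, real_inner_self_eq_norm_sq, ha'.1]; ring
    have hau : 0 < ⟪a, u⟫ := by
      have h1 : ⟪a, u⟫ = ‖u‖ ^ 2 := by
        rw [← real_inner_self_eq_norm_sq]
        conv_rhs => rw [hu, inner_sub_left, inner_smul_left, ← hu, hu0]
        simp
      rw [h1]
      have : u ≠ 0 := fun h2 => by
        rcases eq_or_eq_neg_of_eq_smul ha'.1 hnorm (sub_eq_zero.1 h2) with h3 | h3
        · exact hcon.1 h3.symm
        · exact hcon.2 (by rw [h3, neg_neg])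
      positivity
    obtain ⟨ε, hε, hε0⟩ := ((eventually_near_add_smul D p u).and self_mem_nhdsWithin).exists
    have hε0 : 0 < ε := hε0
    refine h.inner_ne_zero a' ha' (p + ε • u) (hDP.2 _ fun b hb => ?_) ?_
    · by_cases hba : b = a
      · rw [hba, inner_add_right, hp0, inner_smul_right, zero_add]
        exact mul_pos hε0 hau
      · exact hε b hb (hppos b hb hba)
    · rw [inner_add_right, h0, inner_smul_right, hu0, mul_zero, add_zero]
  set H := Subgroup.closure (cs.simple '' {j | e j ∈ (D : Set V)}) with hH
  have hHD : ∀ j, e j ∈ (D : Set V) → cs.simple j ∈ H := fun j hj =>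
    Subgroup.subset_closure ⟨j, hj, rfl⟩
  have hrefl : ∀ a w, ‖a‖ = 1 → r w = (ℝ ∙ a)ᗮ.reflection → w ∈ H := by
    intro a w ha hw
    -- A point of the hyperplane of a on no other hyperplane. Once moved by H into the closed cone
    -- it lies on a wall from D, so w is conjugate in H to the reflection of that wall.
    obtain ⟨v, hav, hv⟩ : ∃ v, ⟪a, v⟫ = 0 ∧
        ∀ b, IsRoot r b → ⟪b, v⟫ = 0 → b = a ∨ b = -a := by
      let T := {b : V // IsRoot r b ∧ b ≠ a ∧ b ≠ -a}
      have : Finite T := ((finite_setOf_isRoot r).subset fun b (hb : IsRoot r b ∧ _) => hb.1)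
      let E := (ℝ ∙ a)ᗮ
      let S : T → Submodule ℝ E := fun b =>
        LinearMap.ker ((innerₛₗ ℝ b.1 : V →ₗ[ℝ] ℝ).comp E.subtype)
      have hS : ⊤ ∉ range S := by
        rintro ⟨⟨b, hb, h1, h2⟩, htop⟩
        have hmem : ∀ v ∈ E, ⟪b, v⟫ = 0 := fun v hv => by
          have : (⟨v, hv⟩ : E) ∈ S ⟨b, hb, h1, h2⟩ := by rw [htop]; trivial
          simpa [S] using this
        have h3 : b - ⟪a, b⟫ • a ∈ E := by
          rw [Submodule.mem_orthogonal_singleton_iff_inner_right, inner_sub_right,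
            inner_smul_right, real_inner_self_eq_norm_sq, ha]
          ring
        have h4 : ⟪a, b - ⟪a, b⟫ • a⟫ = 0 :=
          Submodule.mem_orthogonal_singleton_iff_inner_right.1 h3
        have h5 : ⟪b - ⟪a, b⟫ • a, b - ⟪a, b⟫ • a⟫ = 0 := by
          conv_lhs => rw [inner_sub_left, inner_smul_left, h4, hmem _ h3]
          simp
        rcases eq_or_eq_neg_of_eq_smul ha hb.1 (sub_eq_zero.1 (inner_self_eq_zero.1 h5)) with h6 | h6
        · exact h1 h6
        · exact h2 h6
      have hne := Subspace.biUnion_ne_univ_of_top_notMem (s := (finite_range S).toFinset)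
        (by simpa using hS)
      obtain ⟨v, hv⟩ := (ne_univ_iff_exists_notMem _).1 hne
      refine ⟨v, Submodule.mem_orthogonal_singleton_iff_inner_right.1 v.2, fun b hb h0 => ?_⟩
      by_contra! hcon
      refine hv (mem_iUnion₂.2 ⟨S ⟨b, hb, hcon⟩, by simp, ?_⟩)
      show v ∈ S ⟨b, hb, hcon⟩
      simpa [S] using h0
    obtain ⟨w', hw', hdom⟩ := h.exists_dominant H hHD v
    obtain ⟨j, hj, hj0⟩ : ∃ j, e j ∈ (D : Set V) ∧ ⟪e j, r w' v⟫ = 0 := by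
      by_contra! hcon
      refine h.inner_ne_zero (r w' a) (IsRoot.map_apply ⟨ha, w, hw⟩ w') (r w' v)
        (hDP.2 _ fun b hb => ?_) (by rw [LinearIsometryEquiv.inner_map_map, hav])
      obtain ⟨j, rfl⟩ := hDP.1 hb
      exact lt_of_le_of_ne (hdom j hb) (hcon j hb).symm
    have h1 : ⟪r w'⁻¹ (e j), v⟫ = 0 := by rw [inner_map_left, inv_inv, hj0]
    have h2 : r w = r (w'⁻¹ * cs.simple j * w'⁻¹⁻¹) := by
      rw [hw, map_mul, map_mul, h.map_simple, map_inv r w'⁻¹, conj_reflection (h.norm_eq j)]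
      rcases hv _ ((h.isRoot j).map_apply _) h1 with h3 | h3
      · rw [h3]
      · exact reflection_congr (by rw [h3, span_singleton_neg])
    rw [h.injective h2]
    exact H.mul_mem (H.mul_mem (H.inv_mem hw') (hHD j hj)) (H.inv_mem (H.inv_mem hw'))
  have hall : ∀ j, e j ∈ (D : Set V) := fun j =>
    h.mem_of_simple_mem_closure (hrefl (e j) _ (h.norm_eq j) (h.map_simple j))
  obtain ⟨p, h1, h2, h3⟩ := hwall (e i) (hall i)
  exact ⟨p, h1, fun j hj => h2 _ (hall j) hj, h3⟩

end IsReflectionRep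

end Roots

/-! ### The length as a count of separating hyperplanes. -/

section Length

variable {B W : Type*} [Group W] {M : CoxeterMatrix B} {cs : CoxeterSystem M W}
variable {V : Type*} [NormedAddCommGroup V] [InnerProductSpace ℝ V]

theorem sep_map {Φ : Finset V} {g : V ≃ₗᵢ[ℝ] V} (hg : IsArrangement Φ g) (p q : V) :
    sep Φ (g p) (g q) = sep Φ p q := by
  classical
  unfold sep
  refine Finset.card_bij' (fun a _ => g.symm a) (fun a _ => g a) (fun a ha => ?_) (fun a ha => ?_)
    (fun a _ => by simp) (fun a _ => by simp)
  · obtain ⟨h1, h2, h3⟩ := Finset.mem_filter.1 ha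
    rw [inner_map_eq_inner_symm] at h2 h3
    exact Finset.mem_filter.2 ⟨hg.symm_mem h1, h2, h3⟩
  · obtain ⟨h1, h2, h3⟩ := Finset.mem_filter.1 ha
    refine Finset.mem_filter.2 ⟨hg.map_mem a h1, ?_, ?_⟩ <;>
      rwa [LinearIsometryEquiv.inner_map_map]

theorem isArrangement_roots [Finite W] {r : W →* (V ≃ₗᵢ[ℝ] V)} {g : V ≃ₗᵢ[ℝ] V}
    (hg : ∀ w, ∃ w', g * r w * g⁻¹ = r w') : IsArrangement (roots r) g :=
  ⟨fun _ ha => (mem_roots.1 ha).1, fun _ ha => mem_roots.2 (mem_roots.1 ha).neg,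
    fun _ ha => mem_roots.2 ((mem_roots.1 ha).map hg)⟩

theorem isArrangement_roots_apply [Finite W] (r : W →* (V ≃ₗᵢ[ℝ] V)) (w : W) :
    IsArrangement (roots r) (r w) :=
  isArrangement_roots fun w' => ⟨w * w' * w⁻¹, by simp⟩

namespace IsReflectionRep

variable {r : W →* (V ≃ₗᵢ[ℝ] V)} {e : B → V} {c : V}

theorem generic_apply [Finite W] (h : IsReflectionRep cs r e c) (w : W) :
    Generic (roots r) (r w c) := by
  intro a ha
  rw [inner_map_eq_inner_symm]
  exact h.inner_ne_zero _
    (mem_roots.1 ((isArrangement_roots_apply r w).symm_mem ha)) c h.pos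

/-- A simple reflection changes only the sign of its own root. -/
theorem pos_iff_pos_simple [Finite W] (h : IsReflectionRep cs r e c) {i : B} {a : V}
    (ha : IsRoot r a) (h1 : a ≠ e i) (h2 : a ≠ -e i) :
    0 < ⟪a, c⟫ ↔ 0 < ⟪a, r (cs.simple i) c⟫ := by
  -- The point p is fixed by s i, and every root other than ± e i has the same sign at p as at c.
  obtain ⟨p, hp0, hpos, hp⟩ := h.exists_wall_point i
  have key : ∀ b, IsRoot r b → 0 < ⟪b, p⟫ → 0 < ⟪b, c⟫ := by
    intro b hb hbp
    by_contra! hbc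
    have hbc := lt_of_le_of_ne hbc (h.inner_ne_zero b hb c h.pos)
    refine h.inner_ne_zero b hb (⟪b, p⟫ • c + (-⟪b, c⟫) • p) (fun j => ?_) ?_
    · rw [inner_add_right, inner_smul_right, inner_smul_right]
      refine add_pos_of_pos_of_nonneg (mul_pos hbp (h.pos j)) (mul_nonneg (by linarith) ?_)
      by_cases hj : e j = e i
      · rw [hj, hp0]
      · exact (hpos j hj).le
    · rw [inner_add_right, inner_smul_right, inner_smul_right]
      ring
  have key' : ∀ b, IsRoot r b → b ≠ e i → b ≠ -e i → (0 < ⟪b, p⟫ ↔ 0 < ⟪b, c⟫) := by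
    intro b hb h1 h2
    refine ⟨key b hb, fun hbc => ?_⟩
    by_contra! hbp
    have hbp := lt_of_le_of_ne hbp fun h0 => (hp b hb h0).elim h1 h2
    have := key (-b) hb.neg (by rw [inner_neg_left]; linarith)
    rw [inner_neg_left] at this
    linarith
  have hsi : r (cs.simple i) (e i) = -e i := by
    rw [h.simple_apply, real_inner_self_eq_norm_sq, h.norm_eq]
    module
  have hss : ∀ v, r (cs.simple i) (r (cs.simple i) v) = v := fun v => by
    rw [← map_mul_apply, cs.simple_mul_simple_self, map_one]; rfl
  have h3 : r (cs.simple i) a ≠ e i := fun h0 => h2 (by rw [← hsi, ← h0, hss])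
  have h4 : r (cs.simple i) a ≠ -e i := fun h0 => h1 (by rw [← hss (e i), hsi, ← h0, hss])
  have h5 : ⟪a, r (cs.simple i) c⟫ = ⟪r (cs.simple i) a, c⟫ := by
    rw [inner_map_left, cs.inv_simple]
  rw [h5, ← key' _ (ha.map_apply _) h3 h4, inner_map_left, cs.inv_simple, h.simple_apply, hp0,
    mul_zero, zero_smul, sub_zero, key' a ha h1 h2]

/-- This is the exchange condition. Where the sign of e i changes along the word, the prefix before
that letter m carries e m to ± e i, so s i is a conjugate of s m by the prefix and multiplying by it
deletes the letter. -/
theorem length_simple_mul_wordProd_lt [Finite W] (h : IsReflectionRep cs r e c) (i : B)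
    (ω : List B) (hω : ⟪e i, r (cs.wordProd ω) c⟫ < 0) :
    cs.length (cs.simple i * cs.wordProd ω) < ω.length := by
  induction ω using List.reverseRecOn with
  | nil =>
    have := h.pos i
    simp only [cs.wordProd_nil, map_one] at hω
    exact absurd hω this.le.not_gt
  | append_singleton ω m ih =>
    rw [cs.wordProd_append, cs.wordProd_singleton] at hω ⊢
    rw [List.length_append, List.length_singleton]
    rcases (h.generic_apply (cs.wordProd ω)).pos_or_neg (mem_roots.2 (h.isRoot i)) with h1 | h1
    · have h2 : 0 < ⟪r (cs.wordProd ω)⁻¹ (e i), c⟫ := by rwa [inner_map_left, inv_inv]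
      have h3 : ¬ 0 < ⟪r (cs.wordProd ω)⁻¹ (e i), r (cs.simple m) c⟫ := by
        rw [inner_map_left, inv_inv, ← map_mul_apply]
        exact hω.le.not_gt
      have h4 : r (cs.wordProd ω)⁻¹ (e i) = e m ∨ r (cs.wordProd ω)⁻¹ (e i) = -e m := by
        by_contra! hcon
        exact h3 ((h.pos_iff_pos_simple ((h.isRoot i).map_apply _) hcon.1 hcon.2).1 h2)
      have h5 : cs.simple i = cs.wordProd ω * cs.simple m * (cs.wordProd ω)⁻¹ := by
        apply h.injective
        rw [map_mul, map_mul, h.map_simple, h.map_simple, map_inv, conj_reflection (h.norm_eq m)]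
        refine reflection_congr ?_
        rcases h4 with h4 | h4
        · rw [← h4, map_map_inv_apply]
        · rw [← neg_neg (e m), ← h4, map_neg, map_map_inv_apply, span_singleton_neg]
      have h6 : cs.simple i * (cs.wordProd ω * cs.simple m) = cs.wordProd ω := by
        rw [h5]
        simp [mul_assoc]
      rw [h6]
      exact Nat.lt_succ_of_le (cs.length_wordProd_le ω)
    · have h2 := cs.length_mul_le (cs.simple i * cs.wordProd ω) (cs.simple m)
      rw [cs.length_simple, mul_assoc] at h2
      have := ih h1
      omega

theorem length_simple_mul_of_neg [Finite W] (h : IsReflectionRep cs r e c) {i : B} {w : W}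
    (hw : ⟪e i, r w c⟫ < 0) : cs.length (cs.simple i * w) + 1 = cs.length w := by
  obtain ⟨ω, hω, rfl⟩ := cs.exists_isReduced w
  have h1 := h.length_simple_mul_wordProd_lt i ω hw
  rw [← hω.eq] at h1
  have := cs.length_simple_mul (cs.wordProd ω) i
  omega

/-- Applying s i to both points replaces the pair by s i c and r w c. Passing from c to s i c
changes only the signs of ± e i, and -e i is the one root gained. -/
theorem sep_simple_mul_of_pos [Finite W] (h : IsReflectionRep cs r e c) {i : B} {w : W}
    (hw : 0 < ⟪e i, r w c⟫) :
    sep (roots r) c (r (cs.simple i * w) c) = sep (roots r) c (r w c) + 1 := by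
  classical
  have h1 : c = r (cs.simple i) (r (cs.simple i) c) := by
    rw [← map_mul_apply, cs.simple_mul_simple_self, map_one]; rfl
  have hc := h.pos i
  rw [map_mul_apply]
  nth_rewrite 1 [h1]
  rw [sep_map (isArrangement_roots_apply r _)]
  have h2 : e i ∈ roots r := mem_roots.2 (h.isRoot i)
  have h3 : -e i ∈ roots r := mem_roots.2 (h.isRoot i).neg
  unfold sep
  rw [← Finset.card_insert_of_notMem (a := -e i)]
  · congr 1
    ext a
    rw [Finset.mem_insert, Finset.mem_filter, Finset.mem_filter]
    by_cases ha : a = -e i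
    · subst ha
      simp [h3, h.inner_simple_apply_self, hw, hc]
    by_cases ha' : a = e i
    · subst ha'
      simp [ha, h.inner_simple_apply_self, hw.le]
    constructor
    · rintro ⟨h4, h5, h6⟩
      exact .inr ⟨h4, (h.pos_iff_pos_simple (mem_roots.1 h4) ha' ha).2 h5, h6⟩
    · rintro (h4 | ⟨h4, h5, h6⟩)
      · contradiction
      · exact ⟨h4, (h.pos_iff_pos_simple (mem_roots.1 h4) ha' ha).1 h5, h6⟩
  · intro h4
    have := (Finset.mem_filter.1 h4).2.1
    rw [inner_neg_left] at this
    linarith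

/-- The length is the number of hyperplanes separating the fundamental chamber from its image. -/
theorem length_eq_sep [Finite W] (h : IsReflectionRep cs r e c) (w : W) :
    cs.length w = sep (roots r) c (r w c) := by
  classical
  induction w using cs.simple_induction_left with
  | one =>
    rw [cs.length_one, eq_comm, sep, Finset.card_eq_zero, Finset.filter_eq_empty_iff]
    rintro a - ⟨h1, h2⟩
    rw [map_one] at h2
    exact lt_asymm h1 h2
  | mul_simple_left w i ih =>
    have hs : cs.simple i * (cs.simple i * w) = w := cs.simple_mul_simple_cancel_left i
    have h1 : ⟪e i, r (cs.simple i * w) c⟫ = -⟪e i, r w c⟫ := by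
      rw [map_mul_apply, h.inner_simple_apply_self]
    rcases (h.generic_apply w).pos_or_neg (mem_roots.2 (h.isRoot i)) with h2 | h2
    · rw [h.sep_simple_mul_of_pos h2, ← ih, ← h.length_simple_mul_of_neg (by linarith), hs]
    · have h3 := h.sep_simple_mul_of_pos (i := i) (w := cs.simple i * w) (by linarith)
      have h4 := h.length_simple_mul_of_neg h2
      rw [hs] at h3
      omega

/-- Elements with adjacent chambers differ by a simple reflection. -/
theorem eq_or_eq_mul_simple_of_adjacent [Finite W] (h : IsReflectionRep cs r e c) {p q a : V}
    {u v : W} (hpq : ∀ b ∈ roots r, b ≠ a → b ≠ -a → (0 < ⟪b, p⟫ ↔ 0 < ⟪b, q⟫))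
    (hp : ∀ i, 0 < ⟪e i, r u⁻¹ p⟫) (hq : ∀ i, 0 < ⟪e i, r v⁻¹ q⟫) :
    v = u ∨ ∃ i, v = u * cs.simple i := by
  classical
  have hsign : ∀ (w : W) (y : V), (∀ i, 0 < ⟪e i, r w⁻¹ y⟫) → ∀ b, IsRoot r b →
      (0 < ⟪b, r w c⟫ ↔ 0 < ⟪b, y⟫) := by
    intro w y hy b hb
    have := h.pos_iff_pos (hb.map_apply w⁻¹) h.pos hy
    rwa [inner_map_left, inner_map_left, inv_inv, map_map_inv_apply] at this
  -- A root counted here is sent by u to a or -a, and two opposite roots cannot both be positive on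
  -- c.
  have hlen : cs.length (u⁻¹ * v) ≤ 1 := by
    rw [h.length_eq_sep, sep, Finset.card_le_one]
    have hmem : ∀ b ∈ (roots r).filter fun b => 0 < ⟪b, c⟫ ∧ ⟪b, r (u⁻¹ * v) c⟫ < 0,
        r u b = a ∨ r u b = -a := by
      intro b hb
      obtain ⟨h1, h2, h3⟩ := Finset.mem_filter.1 hb
      have hub : IsRoot r (r u b) := (mem_roots.1 h1).map_apply u
      by_contra! hcon
      have h4 : 0 < ⟪r u b, r u c⟫ := by rwa [LinearIsometryEquiv.inner_map_map]
      have h5 := (hsign v q hq _ hub).2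
        ((hpq _ (mem_roots.2 hub) hcon.1 hcon.2).1 ((hsign u p hp _ hub).1 h4))
      rw [inner_map_left, ← map_mul_apply] at h5
      exact lt_asymm h3 h5
    intro b hb b' hb'
    have h1 := (Finset.mem_filter.1 hb).2.1
    have h2 := (Finset.mem_filter.1 hb').2.1
    have h3 : r u b = r u b' ∨ r u b = -r u b' := by
      rcases hmem b hb with h | h <;> rcases hmem b' hb' with h' | h' <;> simp [h, h']
    rcases h3 with h3 | h3
    · exact (r u).injective h3
    · rw [← map_neg] at h3
      rw [(r u).injective h3, inner_neg_left] at h1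
      linarith
  rcases Nat.le_one_iff_eq_zero_or_eq_one.1 hlen with h1 | h1
  · exact .inl (inv_mul_eq_one.1 (cs.length_eq_zero_iff.1 h1)).symm
  · obtain ⟨i, hi⟩ := cs.length_eq_one_iff.1 h1
    exact .inr ⟨i, by rw [← hi, mul_inv_cancel_left]⟩

end IsReflectionRep

end Length

/-! ### Galleries in W_x and paths of simple conjugations. -/

section Paths

variable {B W : Type*} [Group W] {M : CoxeterMatrix B}

/-- Adjacent elements of `W_x`. -/
def AdjacentIn (cs : CoxeterSystem M W) (δ : MulAut W) (x : TwistedGroup δ) (u v : W) : Prop :=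
  u ∈ lengthFixers cs δ x ∧ v ∈ lengthFixers cs δ x ∧ ∃ i, v = u * cs.simple i

theorem isPath_append_singleton (cs : CoxeterSystem M W) (δ : MulAut W) (l : List B) (i : B) :
    ∀ x : TwistedGroup δ, IsPath cs δ x l →
      len cs δ ((incl δ (cs.wordProd l * cs.simple i))⁻¹ * x *
        incl δ (cs.wordProd l * cs.simple i)) ≤
        len cs δ ((incl δ (cs.wordProd l))⁻¹ * x * incl δ (cs.wordProd l)) →
      IsPath cs δ x (l ++ [i]) := by
  induction l with
  | nil =>
    intro x _ h
    refine ⟨?_, trivial⟩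
    rw [simpleConj_eq]
    simpa using h
  | cons j l ih =>
    intro x hx h
    refine ⟨hx.1, ih _ hx.2 ?_⟩
    rw [simpleConj_eq]
    simpa [cs.wordProd_cons, mul_assoc] using h

theorem exists_path_of_adjacentIn {cs : CoxeterSystem M W} {δ : MulAut W} {x : TwistedGroup δ}
    {w : W} (h : Relation.ReflTransGen (AdjacentIn cs δ x) 1 w) :
    ∃ l ∈ paths cs δ x, cs.wordProd l = w := by
  induction h with
  | refl => exact ⟨[], trivial, cs.wordProd_nil⟩
  | tail _ h ih =>
    obtain ⟨l, hl, rfl⟩ := ih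
    obtain ⟨h1, h2, i, rfl⟩ := h
    exact ⟨l ++ [i], isPath_append_singleton cs δ l i x hl (h2.trans h1.symm).le,
      by rw [cs.wordProd_append, cs.wordProd_singleton]⟩

end Paths

/-! ### Restriction to the span of the roots. -/

section RestrictToSpan

variable {V : Type*} [NormedAddCommGroup V] [InnerProductSpace ℝ V]

theorem sep_subtype (Φ : Finset V) (U : Submodule ℝ V) [DecidablePred (· ∈ U)]
    (hU : ∀ a ∈ Φ, a ∈ U) (p q : U) :
    sep (Finset.subtype (· ∈ U) Φ) p q = sep Φ (p : V) (q : V) := by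
  classical
  unfold sep
  refine Finset.card_bij (fun a _ => (a : V)) (fun a ha => ?_) (fun a _ b _ h => Subtype.ext h)
    (fun a ha => ?_)
  · obtain ⟨h1, h2⟩ := Finset.mem_filter.1 ha
    exact Finset.mem_filter.2 ⟨Finset.mem_subtype.1 h1, h2⟩
  · obtain ⟨h1, h2⟩ := Finset.mem_filter.1 ha
    exact ⟨⟨a, hU a h1⟩, Finset.mem_filter.2 ⟨Finset.mem_subtype.2 h1, h2⟩, rfl⟩

/-- The isometry induced on the span of a stable set of vectors. -/
noncomputable def restrictSpan {Φ : Finset V} {x : V ≃ₗᵢ[ℝ] V} (h : IsArrangement Φ x) :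
    Submodule.span ℝ (Φ : Set V) ≃ₗᵢ[ℝ] Submodule.span ℝ (Φ : Set V) where
  __ := x.toLinearEquiv.ofSubmodules (Submodule.span ℝ (Φ : Set V)) (Submodule.span ℝ (Φ : Set V))
    (by
      refine (Submodule.map_span _ _).trans (congrArg _ (Subset.antisymm ?_ fun a ha => ?_))
      · rintro _ ⟨a, ha, rfl⟩
        exact h.map_mem a ha
      · exact ⟨x.symm a, h.symm_mem ha, x.apply_symm_apply a⟩)
  norm_map' v := x.norm_map v

@[simp] theorem coe_restrictSpan {Φ : Finset V} {x : V ≃ₗᵢ[ℝ] V} (h : IsArrangement Φ x)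
    (v : Submodule.span ℝ (Φ : Set V)) : (restrictSpan h v : V) = x v := rfl

end RestrictToSpan

/-! ### Application to the realization: chains in W_x and connectedness. -/

section Main

variable {B W : Type*} [Group W] {M : CoxeterMatrix B} {δ : MulAut W}
variable {V : Type*} [NormedAddCommGroup V] [InnerProductSpace ℝ V]

namespace Realization

variable {cs : CoxeterSystem M W} (R : Realization cs δ V)

/-- The restriction of the action to `W`. -/
noncomputable def action : W →* (V ≃ₗᵢ[ℝ] V) := R.ρ.comp (incl δ)

theorem action_apply (w : W) : R.action w = R.ρ (incl δ w) := rfl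

/-- The unit simple roots. -/
noncomputable def unitRoot (i : B) : V := ‖R.e i‖⁻¹ • R.e i

theorem norm_unitRoot (i : B) : ‖R.unitRoot i‖ = 1 :=
  norm_smul_inv_norm (𝕜 := ℝ) (R.ne_zero i)

theorem norm_pos (i : B) : 0 < ‖R.e i‖⁻¹ := inv_pos.2 (norm_pos_iff.2 (R.ne_zero i))

theorem mem_openCone_iff {v : V} : v ∈ openCone R.e ↔ ∀ i, 0 < ⟪R.unitRoot i, v⟫ := by
  refine forall_congr' fun i => ?_
  rw [unitRoot, inner_smul_left, real_inner_comm]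
  exact (mul_pos_iff_of_pos_left (R.norm_pos i)).symm

theorem mem_hyperplanes_iff {H : Submodule ℝ V} :
    H ∈ hyperplanes R.ρ ↔ ∃ a, IsRoot R.action a ∧ H = (ℝ ∙ a)ᗮ := by
  constructor
  · rintro ⟨v, hv, rfl, w, hw⟩
    have h1 : (ℝ ∙ (‖v‖⁻¹ • v)) = ℝ ∙ v :=
      Submodule.span_singleton_smul_eq (by simpa using hv) v
    refine ⟨‖v‖⁻¹ • v, ⟨norm_smul_inv_norm (𝕜 := ℝ) hv, w, ?_⟩, by rw [h1]⟩
    exact hw.trans (reflection_congr (by rw [h1]))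
  · rintro ⟨a, ⟨ha, w, hw⟩, rfl⟩
    exact ⟨a, by rintro rfl; simp at ha, rfl, w, hw⟩

theorem openCone_subset : openCone R.e ⊆ hyperplaneComplement R.ρ := by
  obtain ⟨x, -, h⟩ := R.isChamber_openCone
  rw [h]
  exact connectedComponentIn_subset _ _

theorem inner_ne_zero_of_mem {a v : V} (ha : IsRoot R.action a)
    (hv : v ∈ hyperplaneComplement R.ρ) : ⟪a, v⟫ ≠ 0 := fun h0 =>
  hv _ (R.mem_hyperplanes_iff.2 ⟨a, ha, rfl⟩)
    (Submodule.mem_orthogonal_singleton_iff_inner_right.2 h0)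

theorem isReflectionRep {c : V} (hc : c ∈ openCone R.e) :
    IsReflectionRep cs R.action R.unitRoot c where
  injective := R.injective.comp SemidirectProduct.inl_injective
  norm_eq := R.norm_unitRoot
  map_simple i := (R.map_simple i).trans (reflection_congr (by
    rw [unitRoot, Submodule.span_singleton_smul_eq (by simpa using R.ne_zero i)]))
  pos := R.mem_openCone_iff.1 hc
  inner_ne_zero _ ha _ hv := R.inner_ne_zero_of_mem ha (R.openCone_subset (R.mem_openCone_iff.2 hv))

/-- W is the kernel of the projection onto ⟨δ⟩, hence normal; so the whole twisted group permutes
the roots. -/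
theorem exists_conj (g : TwistedGroup δ) (w : W) :
    ∃ w', R.ρ g * R.action w * (R.ρ g)⁻¹ = R.action w' := by
  have h : g * incl δ w * g⁻¹ ∈ (incl δ).range := by
    have : (incl δ).range = SemidirectProduct.rightHom.ker :=
      SemidirectProduct.range_inl_eq_ker_rightHom
    rw [this, MonoidHom.mem_ker]
    simp [incl]
  obtain ⟨w', hw'⟩ := h
  exact ⟨w', by rw [action_apply, action_apply, hw', map_mul, map_mul, map_inv]⟩

theorem image_zpow_openCone (k : ℤ) : (R.ρ (deltaElt δ) ^ k) '' openCone R.e = openCone R.e := by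
  have h0 := R.image_delta
  set f := R.ρ (deltaElt δ)
  have hmul : ∀ g g' : V ≃ₗᵢ[ℝ] V, g '' openCone R.e = openCone R.e →
      g' '' openCone R.e = openCone R.e → (g * g') '' openCone R.e = openCone R.e := by
    intro g g' h h'
    have : ⇑(g * g') = g ∘ g' := rfl
    rw [this, image_comp, h', h]
  have hinv : ⇑f⁻¹ '' openCone R.e = openCone R.e := by
    conv_lhs => rw [← h0, ← image_comp]
    have : ⇑f⁻¹ ∘ ⇑f = id := by
      ext v; exact f.symm_apply_apply v
    rw [this, image_id]
  induction k using Int.induction_on with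
  | zero => simp
  | succ n ih => rw [zpow_add_one]; exact hmul _ _ ih h0
  | pred n ih => rw [zpow_sub_one]; exact hmul _ _ ih hinv

/-- Ellipticity is given at one element y of the class. A conjugating element carries v to a point
fixed by y, hence by W, and such a point is orthogonal to every root. -/
theorem inner_eq_zero_of_isElliptic {O : ConjClasses (TwistedGroup δ)} (hO : R.IsElliptic O)
    {x : TwistedGroup δ} (hx : x ∈ O.carrier) {v : V} (hv : R.ρ x v = v) {a : V}
    (ha : IsRoot R.action a) : ⟪a, v⟫ = 0 := by
  obtain ⟨y, hy, hfix⟩ := hO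
  rw [ConjClasses.mem_carrier_iff_mk_eq] at hx hy
  obtain ⟨g, hg⟩ := isConj_iff.1 (ConjClasses.mk_eq_mk_iff_isConj.1 (hx.trans hy.symm))
  have h1 : R.ρ g v ∈ R.fixedByW := hfix (by
    show R.ρ y (R.ρ g v) = R.ρ g v
    rw [← hg, map_mul, map_mul, map_inv]
    show R.ρ g (R.ρ x ((R.ρ g).symm (R.ρ g v))) = _
    rw [LinearIsometryEquiv.symm_apply_apply, hv])
  have h2 : IsRoot R.action (R.ρ g a) := ha.map (R.exists_conj g)
  obtain ⟨h3, w, hw⟩ := h2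
  have h4 := h1 w
  rw [← R.action_apply, hw, reflection_apply_of_norm h3, sub_eq_self,
    LinearIsometryEquiv.inner_map_map] at h4
  have h5 : R.ρ g a ≠ 0 := fun h0 => by simp [h0] at h3
  simpa using (smul_eq_zero.1 h4).resolve_right h5

variable [Finite W]

theorem isArrangement (g : TwistedGroup δ) : IsArrangement (roots R.action) (R.ρ g) :=
  isArrangement_roots (R.exists_conj g)

/-- The length is the number of hyperplanes separating the fundamental chamber from its image. -/
theorem len_eq_sep {c : V} (hc : c ∈ openCone R.e) (x : TwistedGroup δ) :
    len cs δ x = sep (roots R.action) c (R.ρ x c) := by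
  classical
  have hrep := R.isReflectionRep hc
  set u : W := (x.right⁻¹ : MulAut W) x.left with hu
  obtain ⟨k, hk⟩ := Subgroup.mem_zpowers_iff.1 x.right.2
  have hx : x = deltaElt δ ^ k * incl δ u := by
    have h1 : deltaElt δ ^ k = SemidirectProduct.inr x.right := by
      rw [deltaElt, ← map_zpow]
      congr 1
      exact Subtype.ext hk
    rw [h1]
    refine SemidirectProduct.ext ?_ ?_
    · simp [incl, hu]
    · simp [incl]
  rw [hx, len_deltaElt_zpow_mul, hrep.length_eq_sep]
  have h1 : R.ρ (deltaElt δ ^ k * incl δ u) c = R.ρ (deltaElt δ ^ k) (R.action u c) := by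
    rw [map_mul]; rfl
  -- Since δ^k preserves the cone, c = δ^k c' with c' in the cone; then δ^k cancels from both
  -- arguments and c' may be replaced by c.
  obtain ⟨c', hc', hcc⟩ : c ∈ R.ρ (deltaElt δ ^ k) '' openCone R.e := by
    rw [map_zpow, image_zpow_openCone]; exact hc
  rw [h1]
  conv_rhs => arg 2; rw [← hcc]
  rw [sep_map (R.isArrangement _)]
  unfold sep
  congr 1
  refine Finset.filter_congr fun a ha => and_congr ?_ Iff.rfl
  exact hrep.pos_iff_pos (mem_roots.1 ha) hrep.pos (R.mem_openCone_iff.1 hc')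

/-- The displacement at a point of the chamber of `w`. -/
theorem disp_eq_len {p : V} {w : W} (x : TwistedGroup δ)
    (hp : R.action w⁻¹ p ∈ openCone R.e) :
    disp (roots R.action) (R.ρ x) p = len cs δ ((incl δ w)⁻¹ * x * incl δ w) := by
  rw [R.len_eq_sep hp, ← sep_map (R.isArrangement (incl δ w)), disp, ← R.action_apply,
    map_map_inv_apply]
  congr 1
  rw [map_mul, map_mul, map_inv]
  show _ = R.action w ((R.action w).symm (R.ρ x (R.action w (R.action w⁻¹ p))))
  rw [map_map_inv_apply, LinearIsometryEquiv.apply_symm_apply]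

/-- Orthogonal projection onto the span of the roots does not change the pairings with the simple
roots. -/
theorem exists_mem_openCone_span :
    ∃ c ∈ openCone R.e, c ∈ Submodule.span ℝ (roots R.action : Set V) := by
  obtain ⟨c, hc, h⟩ := R.isChamber_openCone
  have hcC : c ∈ openCone R.e := h ▸ mem_connectedComponentIn hc
  set U := Submodule.span ℝ (roots R.action : Set V) with hU
  have : FiniteDimensional ℝ U := FiniteDimensional.span_finset ℝ _
  refine ⟨U.starProjection c, R.mem_openCone_iff.2 fun i => ?_, U.starProjection_apply_mem c⟩
  have hi : R.unitRoot i ∈ U :=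
    Submodule.subset_span (mem_roots.2 ((R.isReflectionRep hcC).isRoot i))
  rw [← Submodule.inner_starProjection_left_eq_right, Submodule.starProjection_eq_self_iff.2 hi]
  exact R.mem_openCone_iff.1 hcC i

/-- All elements of `W_x` are connected to the identity by adjacent elements of `W_x`. -/
theorem adjacentIn_chain {O : ConjClasses (TwistedGroup δ)} (hO : R.IsElliptic O)
    {x : TwistedGroup δ} (hx : x ∈ minSet cs δ O) {w : W} (hw : w ∈ lengthFixers cs δ x) :
    Relation.ReflTransGen (AdjacentIn cs δ x) 1 w := by
  classical
  obtain ⟨c, hc, hcU⟩ := R.exists_mem_openCone_span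
  have hrep := R.isReflectionRep hc
  set Φ := roots R.action with hΦ
  -- V need not be finite-dimensional, so the chain is built in the span of the roots, where
  -- displacements are the same.
  set U := Submodule.span ℝ (Φ : Set V) with hU
  have hfin : FiniteDimensional ℝ U := FiniteDimensional.span_finset ℝ _
  have hΦU : ∀ a ∈ Φ, a ∈ U := fun a ha => Submodule.subset_span ha
  have harr := R.isArrangement x
  let Ψ : Finset U := Finset.subtype (· ∈ U) Φ
  let X := restrictSpan harr
  have hΨ : IsArrangement Ψ X := by
    refine ⟨fun a ha => harr.norm_eq a (Finset.mem_subtype.1 ha), fun a ha => ?_, fun a ha => ?_⟩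
    · exact Finset.mem_subtype.2 (harr.neg_mem a (Finset.mem_subtype.1 ha))
    · exact Finset.mem_subtype.2 (harr.map_mem a (Finset.mem_subtype.1 ha))
  have hgen : ∀ p : U, Generic Ψ p → Generic Φ (p : V) := fun p hp a ha =>
    hp ⟨a, hΦU a ha⟩ (Finset.mem_subtype.2 ha)
  have hdisp : ∀ (p : U) (u : W), R.action u⁻¹ p ∈ openCone R.e →
      disp Ψ X p = len cs δ ((incl δ u)⁻¹ * x * incl δ u) := by
    intro p u hp
    rw [← R.disp_eq_len x hp]
    exact sep_subtype Φ U hΦU p (X p)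
  have hcover : ∀ p : U, Generic Ψ p → ∃ u, R.action u⁻¹ p ∈ openCone R.e := by
    intro p hp
    obtain ⟨u, hu⟩ := hrep.exists_pos (hgen p hp)
    exact ⟨u⁻¹, by rw [inv_inv]; exact R.mem_openCone_iff.2 hu⟩
  have hlen : ∀ u : W, len cs δ x ≤ len cs δ ((incl δ u)⁻¹ * x * incl δ u) := by
    intro u
    refine hx.2 _ ?_
    have h1 := ConjClasses.mem_carrier_iff_mk_eq.1 hx.1
    rw [ConjClasses.mem_carrier_iff_mk_eq, ← h1, ConjClasses.mk_eq_mk_iff_isConj]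
    exact (isConj_iff.2 ⟨(incl δ u)⁻¹, by simp⟩ : IsConj x _).symm
  have hmin : ∀ p : U, Generic Ψ p → len cs δ x ≤ disp Ψ X p := by
    intro p hp
    obtain ⟨u, hu⟩ := hcover p hp
    rw [hdisp p u hu]
    exact hlen u
  have hmap : ∀ u : W, ∀ p : U, R.action u p ∈ U := by
    intro u p
    exact (restrictSpan (isArrangement_roots_apply R.action u) p).2
  let p₀ : U := ⟨c, hcU⟩
  let q₀ : U := ⟨R.action w c, hmap w p₀⟩
  have hp₀ : R.action (1 : W)⁻¹ (p₀ : V) ∈ openCone R.e := by simpa [p₀] using hc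
  have hq₀ : R.action w⁻¹ (q₀ : V) ∈ openCone R.e := by
    simp only [q₀]
    rwa [map_inv_map_apply]
  have hpd : disp Ψ X p₀ = len cs δ x := by rw [hdisp p₀ 1 hp₀]; simp
  have hqd : disp Ψ X q₀ = len cs δ x := by rw [hdisp q₀ w hq₀]; exact hw
  have hpg : Generic Ψ p₀ := by
    intro a ha
    have := hrep.generic_apply 1 a (Finset.mem_subtype.1 ha)
    simpa using this
  have hqg : Generic Ψ q₀ := fun a ha => hrep.generic_apply w a (Finset.mem_subtype.1 ha)
  have hchain := exists_chain_of_minimal hΨ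
    (fun v hv a ha => R.inner_eq_zero_of_isElliptic hO hx.1 (v := v)
      (by rw [← coe_restrictSpan harr]; exact congrArg Subtype.val hv)
      (mem_roots.1 (Finset.mem_subtype.1 ha)))
    hpg hqg (fun r hr => hpd.trans_le (hmin r hr)) (fun r hr => hqd.trans_le (hmin r hr))
  have key : ∀ q, Relation.ReflTransGen (Step Ψ X) p₀ q → ∀ v : W,
      R.action v⁻¹ (q : V) ∈ openCone R.e → Relation.ReflTransGen (AdjacentIn cs δ x) 1 v := by
    intro q hq
    induction hq with
    | refl =>
      intro v hv
      have h1 : cs.length v⁻¹ = 0 := by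
        rw [hrep.length_eq_sep, sep, Finset.card_eq_zero, Finset.filter_eq_empty_iff]
        rintro a ha ⟨h3, h4⟩
        have := (hrep.pos_iff_pos (mem_roots.1 ha) hrep.pos (R.mem_openCone_iff.1 hv)).1 h3
        exact lt_asymm this h4
      rw [cs.length_inv, cs.length_eq_zero_iff] at h1
      rw [h1]
    | @tail q q' hpq hs ih =>
      intro v' hv'
      have hd' := (reflTransGen_step_symm hmin hpd.le (hpq.tail hs)).2
      obtain ⟨hg, -, -, a, ha⟩ := hs
      obtain ⟨v, hv⟩ := hcover q hg
      have hd := (reflTransGen_step_symm hmin hpd.le hpq).2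
      rw [hdisp q v hv] at hd
      rw [hdisp q' v' hv'] at hd'
      have hadj := hrep.eq_or_eq_mul_simple_of_adjacent (a := (a : V)) (p := q) (q := q')
        (fun b hb h1 h2 => ha ⟨b, hΦU b hb⟩ (Finset.mem_subtype.2 hb)
          (fun h => h1 (congrArg Subtype.val h)) (fun h => h2 (congrArg Subtype.val h)))
        (R.mem_openCone_iff.1 hv) (R.mem_openCone_iff.1 hv')
      rcases hadj with rfl | hadj
      · exact ih v' hv
      · exact (ih v hv).tail ⟨le_antisymm hd (hlen v), le_antisymm hd' (hlen v'), hadj⟩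
  exact key q₀ hchain w hq₀

theorem map_mem_hyperplaneComplement (g : TwistedGroup δ) {v : V}
    (hv : v ∈ hyperplaneComplement R.ρ) : R.ρ g v ∈ hyperplaneComplement R.ρ := by
  intro H hH hvH
  obtain ⟨a, ha, rfl⟩ := R.mem_hyperplanes_iff.1 hH
  rw [Submodule.mem_orthogonal_singleton_iff_inner_right, inner_map_eq_inner_symm] at hvH
  exact R.inner_ne_zero_of_mem
    (mem_roots.1 ((R.isArrangement g).symm_mem (mem_roots.2 ha))) hv hvH

theorem isChamber_image (w : W) : IsChamber R.ρ (R.ρ (incl δ w) '' R.fundamentalChamber) := by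
  obtain ⟨c, hc, h⟩ := R.isChamber_openCone
  refine ⟨R.ρ (incl δ w) c, R.map_mem_hyperplaneComplement _ hc, ?_⟩
  have h1 := (R.ρ (incl δ w)).toHomeomorph.image_connectedComponentIn hc
  have h2 : (R.ρ (incl δ w)).toHomeomorph '' hyperplaneComplement R.ρ =
      hyperplaneComplement R.ρ := by
    refine Subset.antisymm ?_ fun v hv => ?_
    · rintro _ ⟨v, hv, rfl⟩
      exact R.map_mem_hyperplaneComplement _ hv
    · refine ⟨R.ρ (incl δ w)⁻¹ v, R.map_mem_hyperplaneComplement _ hv, ?_⟩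
      rw [map_inv]
      exact (R.ρ (incl δ w)).apply_symm_apply v
  rw [h2] at h1
  rw [fundamentalChamber, h]
  exact h1

theorem image_subset_subregular (w : W) :
    R.ρ (incl δ w) '' R.fundamentalChamber ⊆ R.subregular := by
  rintro _ ⟨v, hv, rfl⟩
  exact .inl ⟨mem_univ _, fun H hH hvH =>
    absurd hvH (R.map_mem_hyperplaneComplement _ (R.openCone_subset hv) H hH)⟩

/-- A point of the i-th wall of C on no other hyperplane is fixed by s i, so its image under w lies
in both closures and is subregular. -/
theorem exists_mem_closure_inter (w : W) (i : B) :
    ∃ v ∈ R.subregular, v ∈ closure (R.ρ (incl δ w) '' R.fundamentalChamber) ∧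
      v ∈ closure (R.ρ (incl δ (w * cs.simple i)) '' R.fundamentalChamber) := by
  obtain ⟨c, hc, -⟩ := R.exists_mem_openCone_span
  have hrep := R.isReflectionRep hc
  obtain ⟨p, hp0, hpos, hp⟩ := hrep.exists_wall_point i
  have hpcl : p ∈ closure R.fundamentalChamber := by
    have h1 : Tendsto (fun t : ℝ => p + t • c) (𝓝[>] 0) (𝓝 p) := by
      have h2 : ContinuousAt (fun t : ℝ => p + t • c) 0 := by fun_prop
      have h3 := h2.tendsto
      simp only [zero_smul, add_zero] at h3
      exact h3.mono_left nhdsWithin_le_nhds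
    refine mem_closure_of_tendsto h1 ?_
    filter_upwards [self_mem_nhdsWithin] with t ht
    refine R.mem_openCone_iff.2 fun j => ?_
    rw [inner_add_right, inner_smul_right]
    refine add_pos_of_nonneg_of_pos ?_ (mul_pos ht (hrep.pos j))
    by_cases hj : R.unitRoot j = R.unitRoot i
    · rw [hj, hp0]
    · exact (hpos j hj).le
  have hcl : ∀ u : W, R.action u p ∈ closure (R.ρ (incl δ u) '' R.fundamentalChamber) := fun u =>
    image_closure_subset_closure_image (R.ρ (incl δ u)).continuous ⟨p, hpcl, rfl⟩
  refine ⟨R.action w p, .inr ⟨(ℝ ∙ R.action w (R.unitRoot i))ᗮ, ?_, ?_, ?_⟩, hcl w, ?_⟩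
  · exact R.mem_hyperplanes_iff.2 ⟨_, (hrep.isRoot i).map_apply w, rfl⟩
  · show R.action w p ∈ (ℝ ∙ R.action w (R.unitRoot i))ᗮ
    rw [Submodule.mem_orthogonal_singleton_iff_inner_right, LinearIsometryEquiv.inner_map_map, hp0]
  · intro H hH hpH
    obtain ⟨a, ha, rfl⟩ := R.mem_hyperplanes_iff.1 hH
    rw [Submodule.mem_orthogonal_singleton_iff_inner_right] at hpH
    have h1 : ⟪R.action w⁻¹ a, p⟫ = 0 := by rw [inner_map_left, inv_inv, hpH]
    have h2 : (ℝ ∙ a) = ℝ ∙ R.action w (R.unitRoot i) := by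
      rcases hp _ (ha.map_apply w⁻¹) h1 with h3 | h3
      · rw [← h3, map_map_inv_apply]
      · rw [← neg_neg (R.unitRoot i), ← h3, map_neg, map_map_inv_apply, span_singleton_neg]
    rw [h2]
  · have h1 : R.action w p = R.action (w * cs.simple i) p := by
      rw [map_mul_apply, hrep.simple_apply, hp0]
      simp
    rw [h1]
    exact hcl _

theorem isConnected_goodRegion {O : ConjClasses (TwistedGroup δ)} (hO : R.IsElliptic O)
    {x : TwistedGroup δ} (hx : x ∈ minSet cs δ O) : IsConnected (R.goodRegion x) := by
  let s : W → Set V := fun w => closure (R.ρ (incl δ w) '' R.fundamentalChamber) ∩ R.subregular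
  have hsub : ∀ w, R.ρ (incl δ w) '' R.fundamentalChamber ⊆ s w := fun w =>
    subset_inter subset_closure (R.image_subset_subregular w)
  have hregion : R.goodRegion x = ⋃ w ∈ lengthFixers cs δ x, s w := by
    refine Subset.antisymm ?_ ?_
    · rintro v ⟨hv, hvs⟩
      obtain ⟨A, ⟨-, w, rfl, hw⟩, hvA⟩ := mem_iUnion₂.1 hv
      exact mem_iUnion₂.2 ⟨w, hw, hvA, hvs⟩
    · intro v hv
      obtain ⟨w, hw, hvA, hvs⟩ := mem_iUnion₂.1 hv
      exact ⟨mem_iUnion₂.2 ⟨_, ⟨R.isChamber_image w, w, rfl, hw⟩, hvA⟩, hvs⟩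
  have hone : (1 : W) ∈ lengthFixers cs δ x := by simp [lengthFixers]
  rw [hregion]
  constructor
  · obtain ⟨c, hc, -⟩ := R.exists_mem_openCone_span
    exact ⟨_, mem_iUnion₂.2 ⟨1, hone, hsub 1 ⟨c, hc, rfl⟩⟩⟩
  -- Each piece lies between a connected chamber and its closure, hence is connected; consecutive
  -- pieces of a gallery through 1 share a subregular point of their common wall.
  · refine IsPreconnected.biUnion_of_reflTransGen (fun w _ => ?_) fun u hu v hv => ?_
    · obtain ⟨y, -, hy⟩ := R.isChamber_image w
      have h1 : IsPreconnected (R.ρ (incl δ w) '' R.fundamentalChamber) := by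
        rw [hy]; exact isPreconnected_connectedComponentIn
      exact h1.subset_closure (hsub w) inter_subset_left
    · have hmeet : ∀ u v, AdjacentIn cs δ x u v → (s u ∩ s v).Nonempty := by
        rintro u _ ⟨-, -, i, rfl⟩
        obtain ⟨y, h1, h2, h3⟩ := R.exists_mem_closure_inter u i
        exact ⟨y, ⟨h2, h1⟩, ⟨h3, h1⟩⟩
      have h1 := R.adjacentIn_chain hO hx hu
      have h2 := R.adjacentIn_chain hO hx hv
      refine Relation.ReflTransGen.trans (b := 1) ?_
        (h2.lift id fun a b h => ⟨hmeet a b h, h.1⟩)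
      induction h1 with
      | refl => exact .refl
      | tail _ h ih =>
        exact .head ⟨by rw [inter_comm]; exact hmeet _ _ h, h.2.1⟩ (ih h.1)

end Realization

end Main

end TwistedCoxeter

theorem mainTheorem2 {B W : Type*} [Group W] [Finite W] {M : CoxeterMatrix B}
    (cs : CoxeterSystem M W) (δ : MulAut W) (hδ : TwistedCoxeter.PreservesSimple cs δ)
    {V : Type*} [NormedAddCommGroup V] [InnerProductSpace ℝ V]
    (R : TwistedCoxeter.Realization cs δ V)
    (O : ConjClasses (TwistedCoxeter.TwistedGroup δ)) (hO : R.IsElliptic O)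
    (x : TwistedCoxeter.TwistedGroup δ) (hx : x ∈ TwistedCoxeter.minSet cs δ O) :
    Function.Surjective (TwistedCoxeter.tau cs δ hx) ∧ IsConnected (R.goodRegion x) := by
  refine ⟨fun w => ?_, R.isConnected_goodRegion hO hx⟩
  obtain ⟨l, hl, hlw⟩ :=
    TwistedCoxeter.exists_path_of_adjacentIn (R.adjacentIn_chain hO hx w.2)
  exact ⟨⟨l, hl⟩, Subtype.ext hlw⟩
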